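/- Let $(\Sigma,\sigma)$ be a complete connected smooth $n$-dimensional Riemannian manifold (without boundary). Write $B_r(p)$ for the open geodesic ball, $\mathcal H^n$ for the $n$-dimensional Hausdorff (i.e. Riemannian volume) measure, and $|Df|$ for the Riemannian norm of the (weak) differential of $f$; unlabelled integrals are with respect to $\mathcal H^n$. Suppose that (VD) there is a constant $C_D>1$ with $\mathcal H^n(B_{2r}(p))\le C_D\,\mathcal H^n(B_r(p))$ for all $p\in\Sigma$ and $r\in(0,1]$; (NP) there is a constant $C_N\ge 1$ such that, for all $p\in\Sigma$, $r\in(0,1]$ and every $f$ in the Sobolev space $W^{1,1}(B_r(p))$, $$\int_{B_r(p)}|f-\bar f_{p,r}|\le C_N\,r\int_{B_r(p)}|Df|,\qquad \bar f_{p,r}=\frac1{\mathcal H^n(B_r(p))}\int_{B_r(p)}f .$$ For a compact set $K\subset\Sigma$ and $t>0$ let $\mathcal L_t(K)$ be the set of locally Lipschitz functions $\phi:\Sigma\to[0,t]$ with $\phi=t$ on $K$ such that $\overline{\operatorname{spt}\phi\setminus K}$ is compact, and put $$\mathrm{cap}_t(K)=\inf_{\phi\in\mathcal L_t(K)}\int_\Sigma\left(\sqrt{1+|D\phi|^2}-1\right),\qquad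 \mathrm{cap}(K)=\inf_{\phi\in\mathcal L_1(K)}\int_\Sigma|D\phi|^2 .$$ Call $\Sigma$ parabolic if $\mathrm{cap}(K)=0$ for some compact $K\subset\Sigma$ with $\mathcal H^n(K)>0$, and M-parabolic if $\mathrm{cap}_t(K)=0$ for some $t>0$ and some compact $K\subset\Sigma$ with $\mathcal H^n(K)>0$. Then $\Sigma$ is parabolic if and only if $\Sigma$ is M-parabolic. -/

import Mathlib

open scoped Manifold ContDiff MeasureTheory Bundle

noncomputable section

namespace GraphCapacity

/-- The functions admissible for the capacities of `K` relative to `Ω` at height `t`: locally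
Lipschitz `φ` with `0 ≤ φ ≤ t`, `φ = t` on `K`, such that the closure of `spt φ \ K` is a compact
subset of `Ω`. -/
def admissible {M : Type*} [MetricSpace M] (t : ℝ) (K Ω : Set M) : Set (M → ℝ) :=
  {φ | LocallyLipschitz φ ∧ IsCompact (closure (tsupport φ \ K)) ∧
    closure (tsupport φ \ K) ⊆ Ω ∧ (∀ x, 0 ≤ φ x ∧ φ x ≤ t) ∧ ∀ x ∈ K, φ x = t}

section Riemannian

variable (n : ℕ) {M : Type*} [MetricSpace M] [ChartedSpace (EuclideanSpace ℝ (Fin n)) M]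
  [Bundle.RiemannianBundle (fun x : M => TangentSpace (𝓡 n) x)]

/-- The pointwise norm `|Dφ|(x)`, i.e. the norm of the differential of `φ` at `x` with respect to
the Riemannian metric. A locally Lipschitz function is differentiable almost everywhere; at the
remaining points the value is `0`. -/
def gradNorm (φ : M → ℝ) (x : M) : ℝ :=
  ‖mvfderiv (𝓡 n) φ x‖

/-- `θ` is a weak differential of `f` on the open set `U`: in every chart, `f` and the components
of `θ` are locally integrable and `θ` is the distributional differential of `f`. -/
def IsWeakDifferentialOn (U : Set M) (f : M → ℝ)
    (θ : ∀ x : M, TangentSpace (𝓡 n) x →L[ℝ] ℝ) : Prop :=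
  ∀ (c : M) (v : EuclideanSpace ℝ (Fin n)),
    let e := extChartAt (𝓡 n) c
    let V : Set (EuclideanSpace ℝ (Fin n)) := e.target ∩ e.symm ⁻¹' U
    let comp : EuclideanSpace ℝ (Fin n) → ℝ := fun y =>
      θ (e.symm y) (mfderiv 𝓘(ℝ, EuclideanSpace ℝ (Fin n)) (𝓡 n) e.symm y v)
    MeasureTheory.LocallyIntegrableOn (fun y => f (e.symm y)) V MeasureTheory.volume ∧
    MeasureTheory.LocallyIntegrableOn comp V MeasureTheory.volume ∧
    ∀ η : EuclideanSpace ℝ (Fin n) → ℝ, ContDiff ℝ ∞ η → HasCompactSupport η → tsupport η ⊆ V →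
      ∫ y, f (e.symm y) * fderiv ℝ η y v = - ∫ y, comp y * η y

variable [MeasurableSpace M] [BorelSpace M]

/-- `f` belongs to the Sobolev space `W^{1,1}(U)`, with weak differential `θ`. Here `μHE[n]` is the
`n`-dimensional Hausdorff measure, normalized so as to be Lebesgue measure on `ℝⁿ`. -/
def IsSobolevOneOne (U : Set M) (f : M → ℝ)
    (θ : ∀ x : M, TangentSpace (𝓡 n) x →L[ℝ] ℝ) : Prop :=
  MeasureTheory.IntegrableOn f U μHE[n] ∧
  MeasureTheory.IntegrableOn (fun x => ‖θ x‖) U μHE[n] ∧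
  IsWeakDifferentialOn n U f θ

/-- `cap_t(K, Ω)`, the capacity given by the relative volume of graphs. -/
def graphCap (t : ℝ) (K Ω : Set M) : ENNReal :=
  ⨅ φ ∈ admissible t K Ω,
    ∫⁻ x in Ω, ENNReal.ofReal (√(1 + gradNorm n φ x ^ 2) - 1) ∂μHE[n]

/-- `cap(K, Ω)`, the classical capacity. -/
def classicalCap (K Ω : Set M) : ENNReal :=
  ⨅ φ ∈ admissible 1 K Ω, ∫⁻ x in Ω, ENNReal.ofReal (gradNorm n φ x ^ 2) ∂μHE[n]

variable (M)

/-- `M` is parabolic: some compact set of positive volume has zero classical capacity in `M`. -/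
def IsParabolic : Prop :=
  ∃ K : Set M, IsCompact K ∧ 0 < μHE[n] K ∧ classicalCap n K Set.univ = 0

/-- `M` is M-parabolic: for some `t > 0` and some compact set `K` of positive volume,
`cap_t(K) = 0`. -/
def IsMParabolic : Prop :=
  ∃ t : ℝ, 0 < t ∧ ∃ K : Set M, IsCompact K ∧ 0 < μHE[n] K ∧ graphCap n t K Set.univ = 0

/-- The local (1,1) Neumann–Poincaré inequality at scales at most `1`. -/
def LocalNeumannPoincare : Prop :=
  ∃ C : ℝ, 1 ≤ C ∧ ∀ (p : M) (r : ℝ), 0 < r → r ≤ 1 →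
    ∀ (f : M → ℝ) (θ : ∀ x : M, TangentSpace (𝓡 n) x →L[ℝ] ℝ),
      IsSobolevOneOne n (Metric.ball p r) f θ →
      ∫⁻ x in Metric.ball p r,
          ENNReal.ofReal |f x - ⨍ y in Metric.ball p r, f y ∂μHE[n]| ∂μHE[n] ≤
        ENNReal.ofReal (C * r) * ∫⁻ x in Metric.ball p r, ENNReal.ofReal ‖θ x‖ ∂μHE[n]

end Riemannian

/-- The local volume doubling property at scales at most `1`. -/
def LocalVolumeDoubling (n : ℕ) (M : Type*) [MetricSpace M] [MeasurableSpace M] [BorelSpace M] :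
    Prop :=
  ∃ C : ℝ, 1 < C ∧ ∀ (p : M) (r : ℝ), 0 < r → r ≤ 1 →
    μHE[n] (Metric.ball p (2 * r)) ≤ ENNReal.ofReal C * μHE[n] (Metric.ball p r)

end GraphCapacity

end

namespace GraphCapacity

set_option linter.unusedSectionVars false

open Set Filter Topology MeasureTheory

/-! ### Inverse charts and the Riemannian distance. -/

section Charts

variable {n : ℕ} {M : Type*} [MetricSpace M] [ChartedSpace (EuclideanSpace ℝ (Fin n)) M]
  [IsManifold (𝓡 n) ∞ M]

/-! One direction is the pointwise bound `√(1 + g²) - 1 ≤ g²`. For the other, the area integrand is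
quadratic for small gradients but only linear for large ones, so a competitor `φ` of small area
energy may have infinite Dirichlet energy. It is therefore averaged over balls of a fixed radius. By
doubling and the Poincaré inequality (`abs_smoothing_sub_le`), the average `S` has at `x` a
Lipschitz constant at most a multiple of `s`, the mean of `|Dφ|` over the ball of radius `1/2` at
`x`; since `φ ≤ t`, it is also at most a multiple of `t`.

If `a` is the mean of the area integrand over that ball, then `s ≤ ε + (3/ε) a` for `0 < ε ≤ 1`. The
choice `ε = √a` when `a ≤ 1`, and the bound by `t` when `a > 1`, show that `|DS|²` is at most a
constant times `a` (`exists_lipschitz_smoothing`). By Tonelli and doubling, averaging is bounded on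
`L¹` (`lintegral_average_le`), so the Dirichlet energy of `S` is controlled by the area energy of
`φ`.

It remains to get a compact set on which the average is bounded below. If `K` has positive measure
in a ball, the Poincaré inequality there makes both `t` and the values of `S` near the centre close
to one constant, so `S ≥ t/2` on a small closed ball once the energy is small
(`exists_energy_threshold`). Then `min (2S/t) 1` is a competitor for that closed ball. Doubling and
completeness make small closed balls compact, which keeps the support compact up to the closed ball
removed. -/

theorem contMDiffOn_chart_symm (c : M) :
    ContMDiffOn 𝓘(ℝ, EuclideanSpace ℝ (Fin n)) (𝓡 n) ∞ (extChartAt (𝓡 n) c).symm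
      (extChartAt (𝓡 n) c).target :=
  contMDiffOn_extChartAt_symm c

theorem mdifferentiableAt_chart_symm {c : M} {y : EuclideanSpace ℝ (Fin n)}
    (hy : y ∈ (extChartAt (𝓡 n) c).target) :
    MDifferentiableAt 𝓘(ℝ, EuclideanSpace ℝ (Fin n)) (𝓡 n) (extChartAt (𝓡 n) c).symm y :=
  ((contMDiffOn_chart_symm c).contMDiffAt ((isOpen_extChartAt_target c).mem_nhds hy)).mdifferentiableAt
    (by simp)

variable [Bundle.RiemannianBundle (fun x : M => TangentSpace (𝓡 n) x)]
  [IsContMDiffRiemannianBundle (𝓡 n) ∞ (EuclideanSpace ℝ (Fin n))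
      (fun x : M => TangentSpace (𝓡 n) x)]

/-- The differential of the inverse of the chart at `c`. -/
noncomputable def chartDeriv (c : M) (y : EuclideanSpace ℝ (Fin n)) :
    EuclideanSpace ℝ (Fin n) →L[ℝ] TangentSpace (𝓡 n) ((extChartAt (𝓡 n) c).symm y) :=
  mfderiv 𝓘(ℝ, EuclideanSpace ℝ (Fin n)) (𝓡 n) (extChartAt (𝓡 n) c).symm y

/-- Weakens smoothness of the metric to continuity, as needed by `ContinuousOn.inner_bundle`. -/
instance instIsContinuousRiemannianBundle :
    IsContinuousRiemannianBundle (EuclideanSpace ℝ (Fin n))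
      (fun x : M => TangentSpace (𝓡 n) x) := by
  obtain ⟨g, hg, h⟩ := IsContMDiffRiemannianBundle.exists_contMDiff (IB := 𝓡 n) (n := ∞)
    (F := EuclideanSpace ℝ (Fin n)) (E := fun x : M => TangentSpace (𝓡 n) x)
  exact ⟨g, hg.continuous, h⟩

/-- The Riemannian norm at the point with coordinates `y` of the vector with coordinates `v`. -/
noncomputable def chartNorm (c : M) (v y : EuclideanSpace ℝ (Fin n)) : ℝ :=
  ‖chartDeriv c y v‖

/-- The tangent map of the inverse chart, applied to the constant field `v`, is a continuous
curve-like section into the tangent bundle, and the norm is the square root of a continuous inner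
product. -/
theorem continuousOn_chartNorm (c : M) (v : EuclideanSpace ℝ (Fin n)) :
    ContinuousOn (chartNorm c v) (extChartAt (𝓡 n) c).target := by
  have h1 : ContinuousOn (tangentMapWithin 𝓘(ℝ, EuclideanSpace ℝ (Fin n)) (𝓡 n)
      (extChartAt (𝓡 n) c).symm (extChartAt (𝓡 n) c).target) _ :=
    (contMDiffOn_chart_symm c).continuousOn_tangentMapWithin (by simp)
      (isOpen_extChartAt_target c).uniqueMDiffOn
  have h2 : Continuous (fun y : EuclideanSpace ℝ (Fin n) =>
      (⟨y, v⟩ : TangentBundle 𝓘(ℝ, EuclideanSpace ℝ (Fin n)) (EuclideanSpace ℝ (Fin n)))) := by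
    have : Continuous (fun y : EuclideanSpace ℝ (Fin n) =>
      (tangentBundleModelSpaceHomeomorph 𝓘(ℝ, EuclideanSpace ℝ (Fin n))).symm (y, v)) := by
      fun_prop
    exact this
  have h3 := h1.comp h2.continuousOn (s := (extChartAt (𝓡 n) c).target) (fun y hy => hy)
  have h4 : ContinuousOn (fun y : EuclideanSpace ℝ (Fin n) =>
      (⟨(extChartAt (𝓡 n) c).symm y, mfderiv 𝓘(ℝ, EuclideanSpace ℝ (Fin n)) (𝓡 n)
        (extChartAt (𝓡 n) c).symm y v⟩ : TangentBundle (𝓡 n) M)) (extChartAt (𝓡 n) c).target := by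
    refine h3.congr fun y hy => ?_
    simp only [Function.comp_apply, tangentMapWithin,
      mfderivWithin_of_isOpen (isOpen_extChartAt_target c) hy]
  have h5 := ContinuousOn.inner_bundle (E := fun x : M => TangentSpace (𝓡 n) x)
    (b := fun y : EuclideanSpace ℝ (Fin n) => (extChartAt (𝓡 n) c).symm y) h4 h4
  refine (h5.sqrt).congr fun y hy => ?_
  simp only [chartNorm]
  exact norm_eq_sqrt_real_inner _

variable [IsRiemannianManifold (𝓡 n) M]

/-- The distance of two points in a convex part of a chart is controlled by the norm of
their coordinate difference. -/
theorem dist_chart_symm_le {c : M} {s : Set (EuclideanSpace ℝ (Fin n))} (hs : Convex ℝ s)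
    (hst : s ⊆ (extChartAt (𝓡 n) c).target) {y z : EuclideanSpace ℝ (Fin n)} (hy : y ∈ s)
    (hz : z ∈ s) {L : ℝ} (hL0 : 0 ≤ L) (hL : ∀ w ∈ s, chartNorm c (z - y) w ≤ L) :
    dist ((extChartAt (𝓡 n) c).symm y) ((extChartAt (𝓡 n) c).symm z) ≤ L := by
  rw [← edist_le_ofReal hL0, IsRiemannianManifold.out (I := 𝓡 n)]
  -- The distance is an infimum of path lengths; the image of the coordinate segment is a competitor
  -- of speed at most `L`.
  let η : ℝ →ᴬ[ℝ] EuclideanSpace ℝ (Fin n) := ContinuousAffineMap.lineMap y z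
  have hη : ∀ t ∈ Icc (0 : ℝ) 1, η t ∈ s := by
    intro t ht
    simp only [η, ContinuousAffineMap.coe_lineMap_eq]
    exact hs.lineMap_mem hy hz ht
  have hsm : ContMDiff 𝓘(ℝ, ℝ) 𝓘(ℝ, EuclideanSpace ℝ (Fin n)) 1 η := by
    rw [contMDiff_iff_contDiff]; exact η.contDiff
  have h1 : ContMDiffOn 𝓘(ℝ, ℝ) (𝓡 n) 1 ((extChartAt (𝓡 n) c).symm ∘ η) (Icc 0 1) :=
    ((contMDiffOn_chart_symm c).of_le (by simp)).comp hsm.contMDiffOn fun t ht => hst (hη t ht)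
  refine (Manifold.riemannianEDist_le_pathELength h1 (by simp [η, ContinuousAffineMap.coe_lineMap_eq])
    (by simp [η, ContinuousAffineMap.coe_lineMap_eq]) zero_le_one).trans ?_
  rw [Manifold.pathELength_eq_lintegral_mfderiv_Icc]
  calc _ ≤ ∫⁻ t in Icc (0 : ℝ) 1, ENNReal.ofReal L := by
        refine setLIntegral_mono' measurableSet_Icc fun t ht => ?_
        have hd : HasDerivAt η (z - y) t := by
          have := AffineMap.hasDerivAt_lineMap (a := y) (b := z) (x := t)
          simpa [η, ContinuousAffineMap.coe_lineMap_eq] using! this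
        rw [mfderiv_comp t (mdifferentiableAt_chart_symm (hst (hη t ht)))
          (hsm.mdifferentiable (by simp) t)]
        have h2 : mfderiv 𝓘(ℝ, ℝ) 𝓘(ℝ, EuclideanSpace ℝ (Fin n)) η t (1 : ℝ) = z - y := by
          rw [mfderiv_eq_fderiv]
          have := hd.hasFDerivAt.fderiv
          rw [this]
          exact one_smul ℝ (z - y)
        have h3 : ‖mfderiv 𝓘(ℝ, EuclideanSpace ℝ (Fin n)) (𝓡 n) (extChartAt (𝓡 n) c).symm (η t)
          (mfderiv 𝓘(ℝ, ℝ) 𝓘(ℝ, EuclideanSpace ℝ (Fin n)) η t (1 : ℝ))‖ ≤ L := by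
          rw [h2]; exact hL _ (hη t ht)
        rw [← ofReal_norm]
        exact ENNReal.ofReal_le_ofReal h3
    _ = _ := by simp

end Charts

/-! ### The differential in charts and its norm. -/

section ChartCalculus

variable {n : ℕ} {M : Type*} [MetricSpace M] [ChartedSpace (EuclideanSpace ℝ (Fin n)) M]
  [IsManifold (𝓡 n) ∞ M]

theorem mdifferentiableAt_of_comp_chart_symm {f : M → ℝ} {c : M} {y : EuclideanSpace ℝ (Fin n)}
    (hy : y ∈ (extChartAt (𝓡 n) c).target)
    (hf : DifferentiableAt ℝ (f ∘ (extChartAt (𝓡 n) c).symm) y) :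
    MDifferentiableAt (𝓡 n) 𝓘(ℝ, ℝ) f ((extChartAt (𝓡 n) c).symm y) := by
  have hx : (extChartAt (𝓡 n) c).symm y ∈ (extChartAt (𝓡 n) c).source :=
    (extChartAt (𝓡 n) c).map_target hy
  have h1 : MDifferentiableAt (𝓡 n) 𝓘(ℝ, EuclideanSpace ℝ (Fin n)) (extChartAt (𝓡 n) c)
      ((extChartAt (𝓡 n) c).symm y) :=
    mdifferentiableAt_extChartAt (by simpa [extChartAt_source] using hx)
  have h2 : MDifferentiableAt 𝓘(ℝ, EuclideanSpace ℝ (Fin n)) 𝓘(ℝ, ℝ)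
      (f ∘ (extChartAt (𝓡 n) c).symm)
      (extChartAt (𝓡 n) c ((extChartAt (𝓡 n) c).symm y)) := by
    rw [(extChartAt (𝓡 n) c).right_inv hy]
    exact hf.mdifferentiableAt
  refine (h2.comp _ h1).congr_of_eventuallyEq ?_
  filter_upwards [(isOpen_extChartAt_source (I := 𝓡 n) c).mem_nhds hx] with z hz
  simp only [Function.comp_apply, (extChartAt (𝓡 n) c).left_inv hz]

/-- This is the chain rule where `f` is differentiable. Elsewhere the coordinate expression is not
differentiable either, so both sides take the default value `0` and no regularity of `f` is needed.
-/
theorem mvfderiv_apply_chart (f : M → ℝ) {c : M} {y : EuclideanSpace ℝ (Fin n)}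
    (hy : y ∈ (extChartAt (𝓡 n) c).target) (v : EuclideanSpace ℝ (Fin n)) :
    mvfderiv (𝓡 n) f ((extChartAt (𝓡 n) c).symm y)
      (chartDeriv c y v) =
    fderiv ℝ (f ∘ (extChartAt (𝓡 n) c).symm) y v := by
  by_cases hf : MDifferentiableAt (𝓡 n) 𝓘(ℝ, ℝ) f ((extChartAt (𝓡 n) c).symm y)
  · have h := mfderiv_comp y hf (mdifferentiableAt_chart_symm hy)
    rw [mfderiv_eq_fderiv] at h
    rw [h]
    rfl
  · rw [fderiv_zero_of_not_differentiableAt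
      fun h => hf (mdifferentiableAt_of_comp_chart_symm hy h)]
    rw [mvfderiv, mfderiv_zero_of_not_mdifferentiableAt hf]
    rfl

theorem exists_mfderiv_chart_symm_eq {c : M} {y : EuclideanSpace ℝ (Fin n)}
    (hy : y ∈ (extChartAt (𝓡 n) c).target)
    (w : TangentSpace (𝓡 n) ((extChartAt (𝓡 n) c).symm y)) :
    ∃ v : EuclideanSpace ℝ (Fin n), chartDeriv c y v = w := by
  have h := mfderivWithin_extChartAt_symm_comp_mfderiv_extChartAt (I := 𝓡 n) hy
  refine ⟨mfderiv (𝓡 n) 𝓘(ℝ, EuclideanSpace ℝ (Fin n)) (extChartAt (𝓡 n) c)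
    ((extChartAt (𝓡 n) c).symm y) w, ?_⟩
  have h' := congr($h w)
  rw [modelWithCornersSelf_coe, range_id, mfderivWithin_univ] at h'
  exact h'

variable [Bundle.RiemannianBundle (fun x : M => TangentSpace (𝓡 n) x)]

/-- The differential of the inverse chart is onto, so the operator norm can be tested on coordinate
vectors. This reduces both measurability and upper bounds of the gradient to Euclidean derivatives.
-/
theorem gradNorm_le_iff (f : M → ℝ) {c : M} {y : EuclideanSpace ℝ (Fin n)}
    (hy : y ∈ (extChartAt (𝓡 n) c).target) {a : ℝ} (ha : 0 ≤ a) :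
    gradNorm n f ((extChartAt (𝓡 n) c).symm y) ≤ a ↔
      ∀ v, |fderiv ℝ (f ∘ (extChartAt (𝓡 n) c).symm) y v| ≤ a * chartNorm c v y := by
  constructor
  · intro h v
    rw [← mvfderiv_apply_chart f hy, ← Real.norm_eq_abs]
    exact ContinuousLinearMap.le_of_opNorm_le _ h _
  · intro h
    refine ContinuousLinearMap.opNorm_le_bound _ ha fun w => ?_
    obtain ⟨v, rfl⟩ := exists_mfderiv_chart_symm_eq hy w
    rw [mvfderiv_apply_chart f hy, Real.norm_eq_abs]
    exact h v

theorem chartNorm_smul (c : M) (a : ℝ) (v y : EuclideanSpace ℝ (Fin n)) :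
    chartNorm c (a • v) y = |a| * chartNorm c v y := by
  simp only [chartNorm]
  rw [map_smul, norm_smul, Real.norm_eq_abs]

theorem chartNorm_nonneg (c : M) (v y : EuclideanSpace ℝ (Fin n)) : 0 ≤ chartNorm c v y :=
  norm_nonneg _

theorem continuous_chartNorm_left (c : M) (y : EuclideanSpace ℝ (Fin n)) :
    Continuous fun v => chartNorm c v y :=
  (chartDeriv c y).continuous.norm

theorem chartNorm_le_sum (c : M) (v y : EuclideanSpace ℝ (Fin n)) :
    chartNorm c v y ≤ (∑ i, chartNorm c (EuclideanSpace.single i 1) y) * ‖v‖ := by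
  have hv : v = ∑ i, v i • EuclideanSpace.single i (1 : ℝ) := by
    ext j
    simp [Pi.single_apply]
  conv_lhs => rw [hv, chartNorm, map_sum]
  refine (norm_sum_le _ _).trans ?_
  rw [Finset.sum_mul]
  refine Finset.sum_le_sum fun i _ => ?_
  rw [map_smul, norm_smul, mul_comm]
  exact mul_le_mul_of_nonneg_left (PiLp.norm_apply_le v i) (norm_nonneg _)

variable [IsContMDiffRiemannianBundle (𝓡 n) ∞ (EuclideanSpace ℝ (Fin n))
      (fun x : M => TangentSpace (𝓡 n) x)]

variable [IsRiemannianManifold (𝓡 n) M]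

/-- The inverse of a chart is locally Lipschitz. -/
theorem exists_lipschitzOnWith_chart_symm {c : M} {y : EuclideanSpace ℝ (Fin n)}
    (hy : y ∈ (extChartAt (𝓡 n) c).target) :
    ∃ C : NNReal, ∃ r > 0, Metric.ball y r ⊆ (extChartAt (𝓡 n) c).target ∧
      LipschitzOnWith C (extChartAt (𝓡 n) c).symm (Metric.ball y r) := by
  have hcont : ContinuousAt (fun z => ∑ i, chartNorm c (EuclideanSpace.single i 1) z) y :=
    tendsto_finsetSum _ fun i _ => (continuousOn_chartNorm c _).continuousAt
      ((isOpen_extChartAt_target c).mem_nhds hy)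
  have hev := (hcont.eventually (gt_mem_nhds (lt_add_one _))).and
    ((isOpen_extChartAt_target c).mem_nhds hy)
  obtain ⟨r, hr, hball⟩ := Metric.eventually_nhds_iff_ball.1 hev
  set C := (∑ i, chartNorm c (EuclideanSpace.single i 1) y) + 1
  have hC : 0 ≤ C := add_nonneg (Finset.sum_nonneg fun i _ => chartNorm_nonneg _ _ _) zero_le_one
  refine ⟨⟨C, hC⟩, r, hr, fun z hz => (hball z hz).2, ?_⟩
  refine LipschitzOnWith.of_dist_le_mul fun z hz z' hz' => ?_
  refine dist_chart_symm_le (convex_ball y r) (fun z hz => (hball z hz).2) hz hz'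
    (mul_nonneg hC dist_nonneg) fun w hw => ?_
  refine (chartNorm_le_sum _ _ _).trans ?_
  rw [dist_comm, dist_eq_norm]
  exact mul_le_mul_of_nonneg_right (hball w hw).1.le (norm_nonneg _)

/-- The norm of the differential is at most the pointwise Lipschitz constant. -/
theorem gradNorm_le_of_eventually_le {f : M → ℝ} {x : M} {L : ℝ} (hL : 0 ≤ L)
    (hf : ∀ᶠ z in 𝓝 x, |f z - f x| ≤ L * dist z x) : gradNorm n f x ≤ L := by
  set e := extChartAt (𝓡 n) x
  have hy : e x ∈ e.target := mem_extChartAt_target x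
  have hex : e.symm (e x) = x := extChartAt_to_inv x
  rw [← hex, gradNorm_le_iff f hy hL]
  intro v
  by_cases hd : DifferentiableAt ℝ (f ∘ e.symm) (e x)
  swap
  · rw [fderiv_zero_of_not_differentiableAt hd]
    simpa using mul_nonneg hL (chartNorm_nonneg _ _ _)
  have hderiv : HasDerivAt (fun s : ℝ => (f ∘ e.symm) (e x + s • v))
      (fderiv ℝ (f ∘ e.symm) (e x) v) 0 :=
    hd.hasFDerivAt.hasLineDerivAt v
  refine le_of_forall_pos_le_add fun ε hε => ?_
  obtain ⟨δ, hδ, hδL⟩ : ∃ δ > 0, L * δ ≤ ε := by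
    refine ⟨ε / (L + 1), by positivity, ?_⟩
    rw [← mul_div_assoc, div_le_iff₀ (by positivity)]
    nlinarith
  have hc0 : 0 ≤ chartNorm x v (e x) + δ := add_nonneg (chartNorm_nonneg _ _ _) hδ.le
  have hev : ∀ᶠ z in 𝓝 (e x), chartNorm x v z < chartNorm x v (e x) + δ ∧ z ∈ e.target :=
    (((continuousOn_chartNorm x v).continuousAt
      ((isOpen_extChartAt_target x).mem_nhds hy)).eventually
        (gt_mem_nhds (lt_add_of_pos_right _ hδ))).and ((isOpen_extChartAt_target x).mem_nhds hy)
  obtain ⟨r, hr, hball⟩ := Metric.eventually_nhds_iff_ball.1 hev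
  have hline : Tendsto (fun s : ℝ => e x + s • v) (𝓝 0) (𝓝 (e x)) := by
    have : Continuous fun s : ℝ => e x + s • v := by fun_prop
    simpa using this.tendsto 0
  have hsymm : Tendsto (fun s : ℝ => e.symm (e x + s • v)) (𝓝 0) (𝓝 x) := by
    have h1 : ContinuousAt e.symm (e x) := continuousAt_extChartAt_symm x
    have := h1.tendsto.comp hline
    rwa [hex] at this
  -- Along the coordinate line `s ↦ e x + s • v`, the Riemannian distance from `x` is at most
  -- `(chartNorm x v (e x) + δ) |s|` for small `s`.
  have key := hderiv.le_of_lip' (C := L * (chartNorm x v (e x) + δ)) (mul_nonneg hL hc0) ?_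
  · rw [Real.norm_eq_abs] at key
    refine key.trans ?_
    rw [mul_add]
    gcongr
  · filter_upwards [hsymm.eventually hf, hline.eventually (Metric.ball_mem_nhds _ hr)] with s h1 h2
    simp only [Function.comp_apply, zero_smul, add_zero, sub_zero, hex, Real.norm_eq_abs]
    refine h1.trans ?_
    rw [mul_assoc]
    refine mul_le_mul_of_nonneg_left ?_ hL
    have h3 := dist_chart_symm_le (c := x) (convex_ball (e x) r) (fun z hz => (hball z hz).2)
      (Metric.mem_ball_self hr) h2 (L := (chartNorm x v (e x) + δ) * |s|)
      (mul_nonneg hc0 (abs_nonneg _)) ?_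
    · rw [dist_comm]
      change dist (e.symm (e x)) _ ≤ _ at h3
      rwa [hex] at h3
    · intro w hw
      rw [add_sub_cancel_left, chartNorm_smul, mul_comm]
      exact mul_le_mul_of_nonneg_right (hball w hw).1.le (abs_nonneg _)

end ChartCalculus

/-! ### Integration by parts for locally Lipschitz functions on Euclidean space. -/

section Compact

/-- A locally Lipschitz function with compact support is Lipschitz. -/
theorem exists_lipschitzWith_of_hasCompactSupport {E : Type*} [NormedAddCommGroup E]
    [ProperSpace E] {g : E → ℝ} (hg : LocallyLipschitz g) (hc : HasCompactSupport g) :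
    ∃ C : NNReal, LipschitzWith C g := by
  obtain ⟨R, hR⟩ := hc.isCompact.isBounded.subset_closedBall (0 : E)
  obtain ⟨K, hK⟩ := (hg.locallyLipschitzOn (s := Metric.closedBall (0 : E) (R + 1))
    ).exists_lipschitzOnWith_of_compact (isCompact_closedBall _ _)
  obtain ⟨B, hB⟩ := hc.exists_bound_of_continuous hg.continuous
  have hB0 : 0 ≤ B := (norm_nonneg _).trans (hB 0)
  have hzero : ∀ z, z ∉ Metric.closedBall (0 : E) R → g z = 0 := fun z hz =>
    image_eq_zero_of_notMem_tsupport fun h => hz (hR h)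
  -- Such points are at distance at least `1`, so the sup bound `B` serves as a Lipschitz constant.
  have hfar : ∀ x y, x ∈ Metric.closedBall (0 : E) R → y ∉ Metric.closedBall (0 : E) (R + 1) →
      dist (g x) (g y) ≤ (K + B) * dist x y := by
    intro x y hx hy
    have hy' : g y = 0 := hzero y fun h => hy (Metric.closedBall_subset_closedBall (by simp) h)
    have h1 : 1 ≤ dist x y := by
      simp only [Metric.mem_closedBall, not_le] at hx hy
      have := dist_triangle y x 0
      rw [dist_comm y x] at this
      linarith
    rw [hy', dist_zero_right]
    have := hB x
    nlinarith [K.coe_nonneg]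
  refine ⟨K + ⟨B, hB0⟩, LipschitzWith.of_dist_le_mul fun x y => ?_⟩
  change _ ≤ ((K : ℝ) + B) * _
  by_cases hx : x ∈ Metric.closedBall (0 : E) (R + 1) <;>
    by_cases hy : y ∈ Metric.closedBall (0 : E) (R + 1)
  · refine (hK.dist_le_mul x hx y hy).trans ?_
    exact mul_le_mul_of_nonneg_right (by simpa using hB0) dist_nonneg
  · by_cases hx' : x ∈ Metric.closedBall (0 : E) R
    · exact hfar x y hx' hy
    · rw [hzero x hx', hzero y fun h => hy (Metric.closedBall_subset_closedBall (by simp) h)]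
      simp only [dist_self]
      positivity
  · by_cases hy' : y ∈ Metric.closedBall (0 : E) R
    · rw [dist_comm, dist_comm x]
      exact hfar y x hy' hx
    · rw [hzero y hy', hzero x fun h => hx (Metric.closedBall_subset_closedBall (by simp) h)]
      simp only [dist_self]
      positivity
  · rw [hzero x fun h => hx (Metric.closedBall_subset_closedBall (by simp) h),
      hzero y fun h => hy (Metric.closedBall_subset_closedBall (by simp) h)]
    simp only [dist_self]
    positivity

/-- Integration by parts against a test function for a function which is locally Lipschitz on an
open set. -/
theorem integral_mul_fderiv_eq_neg {n : ℕ} {g : EuclideanSpace ℝ (Fin n) → ℝ}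
    {s : Set (EuclideanSpace ℝ (Fin n))} (hs : IsOpen s)
    (hg : ∀ y ∈ s, ∃ C : NNReal, ∃ r > 0, Metric.ball y r ⊆ s ∧
      LipschitzOnWith C g (Metric.ball y r)) (v : EuclideanSpace ℝ (Fin n)) :
    LocallyIntegrableOn g s ∧ LocallyIntegrableOn (fun y => fderiv ℝ g y v) s ∧
    ∀ η : EuclideanSpace ℝ (Fin n) → ℝ, ContDiff ℝ ∞ η → HasCompactSupport η → tsupport η ⊆ s →
      ∫ y, g y * fderiv ℝ η y v = - ∫ y, fderiv ℝ g y v * η y := by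
  have hcont : ContinuousOn g s := by
    intro y hy
    obtain ⟨C, r, hr, -, h⟩ := hg y hy
    exact (h.continuousOn.continuousAt (Metric.ball_mem_nhds y hr)).continuousWithinAt
  have hint : LocallyIntegrableOn g s := hcont.locallyIntegrableOn hs.measurableSet
  have hint' : LocallyIntegrableOn (fun y => fderiv ℝ g y v) s := by
    intro y hy
    obtain ⟨C, r, hr, -, h⟩ := hg y hy
    refine ⟨Metric.ball y r, mem_nhdsWithin_of_mem_nhds (Metric.ball_mem_nhds y hr), ?_⟩
    refine IntegrableOn.of_bound measure_ball_lt_top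
      (measurable_fderiv_apply_const ℝ g v).aestronglyMeasurable (C * ‖v‖) ?_
    refine (ae_restrict_iff' Metric.isOpen_ball.measurableSet).2 (ae_of_all _ fun z hz => ?_)
    refine ContinuousLinearMap.le_of_opNorm_le _ ?_ _
    exact norm_fderiv_le_of_lipschitzOn ℝ (Metric.isOpen_ball.mem_nhds hz) h
  refine ⟨hint, hint', fun η hη hηc hηs => ?_⟩
  have hdiff : ∀ᵐ y : EuclideanSpace ℝ (Fin n), y ∈ s → DifferentiableAt ℝ g y := by
    have : volume {y | y ∈ s ∧ ¬ DifferentiableAt ℝ g y} = 0 := by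
      refine measure_null_of_locally_null _ fun y hy => ?_
      obtain ⟨C, r, hr, -, h⟩ := hg y hy.1
      refine ⟨_, inter_mem_nhdsWithin _ (Metric.ball_mem_nhds y hr), ?_⟩
      refine measure_mono_null ?_ (ae_iff.1
        (h.ae_differentiableWithinAt_of_mem (μ := (volume : Measure (EuclideanSpace ℝ (Fin n))))))
      rintro z ⟨hz, hzb⟩ hcon
      exact hz.2 ((hcon hzb).differentiableAt (Metric.isOpen_ball.mem_nhds hzb))
    rw [ae_iff]
    refine measure_mono_null ?_ this
    intro y hy
    simpa using hy
  set G := fun y => g y * η y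
  have hGc : HasCompactSupport G := hηc.mul_left
  have hηd : ContDiff ℝ 1 η := hη.of_le (by simp)
  have hGloc : LocallyLipschitz G := by
    intro y
    by_cases hy : y ∈ tsupport η
    · obtain ⟨C, r, hr, -, h⟩ := hg y (hηs hy)
      obtain ⟨D, t, ht, hD⟩ := hηd.locallyLipschitz y
      have hyb := Metric.ball_mem_nhds y hr
      obtain ⟨A, hA⟩ : ∃ A : NNReal, ∀ᶠ z in 𝓝 y, |g z| ≤ A := by
        refine ⟨⟨|g y| + 1, by positivity⟩, ?_⟩
        exact (((h.continuousOn.continuousAt hyb).abs).eventually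
          (gt_mem_nhds (lt_add_one _))).mono fun z hz => le_of_lt hz
      obtain ⟨B, hB⟩ : ∃ B : NNReal, ∀ z, |η z| ≤ B := by
        obtain ⟨B, hB⟩ := hηc.exists_bound_of_continuous hη.continuous
        exact ⟨⟨B, (norm_nonneg _).trans (hB y)⟩, hB⟩
      refine ⟨A * D + C * B, _, inter_mem (inter_mem ht hyb) hA, ?_⟩
      refine LipschitzOnWith.of_dist_le_mul fun z hz w hw => ?_
      have e1 := hD.dist_le_mul z hz.1.1 w hw.1.1
      have e2 := h.dist_le_mul z hz.1.2 w hw.1.2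
      have e3 : |g z| ≤ A := hz.2
      have e4 := hB w
      rw [Real.dist_eq] at e1 e2 ⊢
      have e5 : G z - G w = g z * (η z - η w) + (g z - g w) * η w := by simp only [G]; ring
      rw [e5]
      refine (abs_add_le _ _).trans ?_
      rw [abs_mul, abs_mul]
      push_cast
      have := mul_le_mul e3 e1 (abs_nonneg _) A.coe_nonneg
      have := mul_le_mul e2 e4 (abs_nonneg _) (by positivity)
      linarith
    · refine ⟨0, (tsupport η)ᶜ, (isClosed_tsupport η).isOpen_compl.mem_nhds hy, ?_⟩
      refine LipschitzOnWith.of_dist_le_mul fun z hz w hw => ?_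
      simp [G, image_eq_zero_of_notMem_tsupport hz, image_eq_zero_of_notMem_tsupport hw]
  obtain ⟨D, hD⟩ := exists_lipschitzWith_of_hasCompactSupport hGloc hGc
  -- Pairing `G = g η` with the constant `1` says that the integral of the derivative of `G` along
  -- `v` vanishes; the product rule then gives the claim.
  have h0 := (LipschitzWith.const (1 : ℝ) (α := EuclideanSpace ℝ (Fin n))
    ).integral_lineDeriv_mul_eq (μ := volume) hD hGc (-v)
  have hconst : ∀ (a : ℝ) (x w : EuclideanSpace ℝ (Fin n)),
      lineDeriv ℝ (fun _ : EuclideanSpace ℝ (Fin n) => a) x w = 0 := by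
    intro a x w
    simp [lineDeriv]
  simp only [neg_neg, mul_one, hconst, zero_mul, integral_zero] at h0
  have hae : (fun y => lineDeriv ℝ G y v) =ᵐ[volume]
      fun y => g y * fderiv ℝ η y v + fderiv ℝ g y v * η y := by
    filter_upwards [hdiff] with y hy
    by_cases hys : y ∈ tsupport η
    · have h1 := (hy (hηs hys)).hasFDerivAt.mul (hηd.differentiable (by simp) y).hasFDerivAt
      have h2 := (h1.hasLineDerivAt v).lineDeriv
      have h3 : (g * η) = G := rfl
      rw [h3] at h2
      rw [h2]
      simp [mul_comm]
    · have h1 : G =ᶠ[𝓝 y] fun _ => (0 : ℝ) := by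
        filter_upwards [(isClosed_tsupport η).isOpen_compl.mem_nhds hys] with z hz
        simp [G, image_eq_zero_of_notMem_tsupport hz]
      have h2 : η =ᶠ[𝓝 y] fun _ => (0 : ℝ) := by
        filter_upwards [(isClosed_tsupport η).isOpen_compl.mem_nhds hys] with z hz
        simp [image_eq_zero_of_notMem_tsupport hz]
      rw [h1.lineDeriv_eq, h2.fderiv_eq, h2.eq_of_nhds, hconst]
      simp
  rw [integral_congr_ae hae] at h0
  have hη' : Continuous fun y => fderiv ℝ η y v :=
    (hηd.continuous_fderiv (by simp)).clm_apply continuous_const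
  have hi1 : Integrable fun y => g y * fderiv ℝ η y v := by
    refine (integrableOn_iff_integrable_of_support_subset (s := tsupport η) ?_).1
      ((hint.integrableOn_compact_subset hηs hηc).mul_continuousOn hη'.continuousOn hηc)
    intro y hy
    by_contra h
    have h2 : η =ᶠ[𝓝 y] fun _ => (0 : ℝ) := by
      filter_upwards [(isClosed_tsupport η).isOpen_compl.mem_nhds h] with z hz
      simp [image_eq_zero_of_notMem_tsupport hz]
    simp [h2.fderiv_eq] at hy
  have hi2 : Integrable fun y => fderiv ℝ g y v * η y := by
    refine (integrableOn_iff_integrable_of_support_subset (s := tsupport η) ?_).1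
      ((hint'.integrableOn_compact_subset hηs hηc).mul_continuousOn hη.continuous.continuousOn hηc)
    intro y hy
    by_contra h
    simp [image_eq_zero_of_notMem_tsupport h] at hy
  rw [integral_add hi1 hi2] at h0
  linarith

end Compact

/-! ### Weak differentials, measurability of the gradient, local finiteness of the volume. -/

section Sobolev

variable {n : ℕ} {M : Type*} [MetricSpace M] [ChartedSpace (EuclideanSpace ℝ (Fin n)) M]
  [IsManifold (𝓡 n) ∞ M] [Bundle.RiemannianBundle (fun x : M => TangentSpace (𝓡 n) x)]
  [IsContMDiffRiemannianBundle (𝓡 n) ∞ (EuclideanSpace ℝ (Fin n))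
      (fun x : M => TangentSpace (𝓡 n) x)] [IsRiemannianManifold (𝓡 n) M]

/-- The differential of a locally Lipschitz function is its weak differential. -/
theorem isWeakDifferentialOn_mvfderiv {f : M → ℝ} (hf : LocallyLipschitz f) (U : Set M) :
    IsWeakDifferentialOn n U f (mvfderiv (𝓡 n) f) := by
  intro c v
  set e := extChartAt (𝓡 n) c
  have hg : ∀ y ∈ e.target, ∃ C : NNReal, ∃ r > 0, Metric.ball y r ⊆ e.target ∧
      LipschitzOnWith C (f ∘ e.symm) (Metric.ball y r) := by
    intro y hy
    obtain ⟨C, r, hr, hrs, h⟩ := exists_lipschitzOnWith_chart_symm hy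
    obtain ⟨D, t, ht, hD⟩ := hf (e.symm y)
    have hpre : e.symm ⁻¹' t ∈ 𝓝 y :=
      (h.continuousOn.continuousAt (Metric.ball_mem_nhds y hr)).preimage_mem_nhds ht
    obtain ⟨r', hr', hsub⟩ := Metric.mem_nhds_iff.1 (inter_mem hpre (Metric.ball_mem_nhds y hr))
    refine ⟨D * C, r', hr', fun z hz => hrs (hsub hz).2, ?_⟩
    exact hD.comp (h.mono fun z hz => (hsub hz).2) fun z hz => (hsub hz).1
  obtain ⟨h1, h2, h3⟩ := integral_mul_fderiv_eq_neg (isOpen_extChartAt_target c) hg v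
  have hcomp : ∀ y ∈ e.target, mvfderiv (𝓡 n) f (e.symm y)
      (mfderiv 𝓘(ℝ, EuclideanSpace ℝ (Fin n)) (𝓡 n) e.symm y v) =
        fderiv ℝ (f ∘ e.symm) y v := fun y hy => mvfderiv_apply_chart f hy v
  refine ⟨h1.mono_set inter_subset_left, LocallyIntegrableOn.mono_set ?_ inter_subset_left, ?_⟩
  · intro y hy
    obtain ⟨t, ht, hti⟩ := h2 y hy
    refine ⟨t ∩ e.target, inter_mem ht self_mem_nhdsWithin, ?_⟩
    rw [inter_comm]
    refine IntegrableOn.congr_fun_ae (hti.mono_set inter_subset_right) ?_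
    have hm : ∀ᵐ z ∂(volume : Measure (EuclideanSpace ℝ (Fin n))).restrict e.target,
        z ∈ e.target := ae_restrict_mem (isOpen_extChartAt_target c).measurableSet
    refine (ae_restrict_of_ae_restrict_of_subset inter_subset_left hm).mono fun z hz => ?_
    exact (hcomp z hz).symm
  · intro η hη hηc hηs
    refine (h3 η hη hηc (hηs.trans inter_subset_left)).trans ?_
    congr 1
    refine integral_congr_ae (ae_of_all _ fun y => ?_)
    by_cases hy : y ∈ tsupport η
    · simp only
      rw [hcomp y (hηs hy).1]
    · simp [image_eq_zero_of_notMem_tsupport hy]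

variable [MeasurableSpace M] [BorelSpace M]

theorem gradNorm_nonneg (f : M → ℝ) (x : M) : 0 ≤ gradNorm n f x :=
  ContinuousLinearMap.opNorm_nonneg _

/-- The norm of the differential is measurable. -/
theorem measurable_gradNorm [SecondCountableTopology M] (f : M → ℝ) :
    Measurable (gradNorm n f) := by
  refine measurable_of_Iic fun a => ?_
  by_cases ha : 0 ≤ a
  swap
  · have : gradNorm n f ⁻¹' Iic a = ∅ := by
      ext x
      simp only [mem_preimage, mem_Iic, mem_empty_iff_false, iff_false, not_le]
      exact (not_le.1 ha).trans_le (gradNorm_nonneg f x)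
    rw [this]; exact MeasurableSet.empty
  obtain ⟨D, hDc, hDd⟩ := TopologicalSpace.exists_countable_dense (EuclideanSpace ℝ (Fin n))
  obtain ⟨S, hSc, hS⟩ := TopologicalSpace.countable_cover_nhds
    fun x : M => extChartAt_source_mem_nhds (I := 𝓡 n) x
  classical
  let N (c : M) (v : EuclideanSpace ℝ (Fin n)) : EuclideanSpace ℝ (Fin n) → ℝ :=
    (extChartAt (𝓡 n) c).target.piecewise (chartNorm c v) (fun _ => 0)
  have hN : ∀ c v, Measurable (N c v) := fun c v =>
    (continuousOn_chartNorm c v).measurable_piecewise continuousOn_const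
      (isOpen_extChartAt_target c).measurableSet
  let φ (c : M) : M → EuclideanSpace ℝ (Fin n) :=
    (extChartAt (𝓡 n) c).source.piecewise (extChartAt (𝓡 n) c) (fun _ => 0)
  have hφ : ∀ c, Measurable (φ c) := fun c =>
    (continuousOn_extChartAt c).measurable_piecewise continuousOn_const
      (isOpen_extChartAt_source c).measurableSet
  -- Countably many charts cover `M`, and by continuity in `v` the criterion `gradNorm_le_iff` need
  -- only be tested on a countable dense set.
  have key : gradNorm n f ⁻¹' Iic a = ⋃ c ∈ S, ((extChartAt (𝓡 n) c).source ∩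
      φ c ⁻¹' ⋂ v ∈ D, {y | |fderiv ℝ (f ∘ (extChartAt (𝓡 n) c).symm) y v| ≤ a * N c v y}) := by
    have hchart : ∀ c, ∀ x ∈ (extChartAt (𝓡 n) c).source, (gradNorm n f x ≤ a ↔
        ∀ v ∈ D, |fderiv ℝ (f ∘ (extChartAt (𝓡 n) c).symm) (φ c x) v| ≤ a * N c v (φ c x)) := by
      intro c x hx
      have h1 : φ c x = extChartAt (𝓡 n) c x := Set.piecewise_eq_of_mem _ _ _ hx
      have h2 : φ c x ∈ (extChartAt (𝓡 n) c).target := by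
        rw [h1]; exact (extChartAt (𝓡 n) c).map_source hx
      have h3 : (extChartAt (𝓡 n) c).symm (φ c x) = x := by
        rw [h1]; exact (extChartAt (𝓡 n) c).left_inv hx
      have h4 : ∀ v, N c v (φ c x) = chartNorm c v (φ c x) := fun v =>
        Set.piecewise_eq_of_mem _ _ _ h2
      simp only [h4]
      have h5 := gradNorm_le_iff f h2 ha
      rw [h3] at h5
      rw [h5]
      refine ⟨fun h v _ => h v, fun h v => ?_⟩
      have hcl : IsClosed {v | |fderiv ℝ (f ∘ (extChartAt (𝓡 n) c).symm) (φ c x) v| ≤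
          a * chartNorm c v (φ c x)} :=
        isClosed_le (by fun_prop) (continuous_const.mul (continuous_chartNorm_left c _))
      exact hcl.closure_subset_iff.2 h (hDd v)
    ext x
    simp only [mem_preimage, mem_Iic, mem_iUnion, mem_inter_iff, mem_iInter, mem_ofPred_eq,
      exists_prop]
    constructor
    · intro h
      have hx : x ∈ ⋃ c ∈ S, (extChartAt (𝓡 n) c).source := by rw [hS]; trivial
      simp only [mem_iUnion, exists_prop] at hx
      obtain ⟨c, hc, hxc⟩ := hx
      exact ⟨c, hc, hxc, (hchart c x hxc).1 h⟩
    · rintro ⟨c, hc, hxc, h⟩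
      exact (hchart c x hxc).2 h
  rw [key]
  refine MeasurableSet.biUnion hSc fun c _ => (isOpen_extChartAt_source c).measurableSet.inter
    (hφ c (MeasurableSet.biInter hDc fun v _ => ?_))
  exact measurableSet_le (measurable_fderiv_apply_const ℝ _ v).abs ((hN c v).const_mul a)

/-- The Riemannian volume is locally finite. -/
theorem exists_measure_ball_lt_top (x : M) : ∃ r > 0, (μHE[n] : Measure M) (Metric.ball x r) < ⊤ := by
  set e := extChartAt (𝓡 n) x
  obtain ⟨C, r, hr, hrs, h⟩ := exists_lipschitzOnWith_chart_symm (mem_extChartAt_target (I := 𝓡 n) x)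
  have hn : e.symm '' (Metric.ball (e x) r) ∈ 𝓝 x := by
    have h1 : e ⁻¹' (Metric.ball (e x) r) ∈ 𝓝 x :=
      (continuousAt_extChartAt x).preimage_mem_nhds (Metric.ball_mem_nhds _ hr)
    filter_upwards [h1, extChartAt_source_mem_nhds (I := 𝓡 n) x] with z hz hzs
    exact ⟨e z, hz, e.left_inv hzs⟩
  obtain ⟨ρ, hρ, hsub⟩ := Metric.mem_nhds_iff.1 hn
  refine ⟨ρ, hρ, (measure_mono hsub).trans_lt ?_⟩
  have hvol : (μHE[n] : Measure (EuclideanSpace ℝ (Fin n))) (Metric.ball (e x) r) < ⊤ := by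
    rw [EuclideanSpace.euclideanHausdorffMeasure_eq_volume]
    exact measure_ball_lt_top
  -- The normalizing factor depends on `n` only, so the Lipschitz bound for `μH` carries over.
  rw [Measure.euclideanHausdorffMeasure_def, Measure.smul_apply, ENNReal.smul_def, smul_eq_mul]
    at hvol ⊢
  refine (mul_le_mul_right (h.hausdorffMeasure_image_le n.cast_nonneg) _).trans_lt ?_
  rw [mul_left_comm]
  exact ENNReal.mul_lt_top (by simp) hvol

end Sobolev

/-! ### Locally doubling measures. -/

section Doubling

variable {X : Type*} [MetricSpace X] [MeasurableSpace X] [BorelSpace X]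

/-- A measure for which small balls have finite positive measure and which is doubling with
constant `C` at scales at most `1`. -/
structure LocalDoubling (μ : Measure X) (C : ℝ) : Prop where
  one_lt : 1 < C
  measure_ball_lt_top : ∀ x r, r ≤ 2 → μ (Metric.ball x r) < ⊤
  measure_ball_pos : ∀ x r, 0 < r → 0 < μ (Metric.ball x r)
  doubling : ∀ x r, 0 < r → r ≤ 1 → μ.real (Metric.ball x (2 * r)) ≤ C * μ.real (Metric.ball x r)

/-- Spreads finiteness or vanishing of the measure from an arbitrarily small ball to radius `2` by
repeated doubling. -/
theorem ball_induction {P : Set X → Prop} {x : X} (hmono : ∀ s t : Set X, s ⊆ t → P t → P s)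
    (hstep : ∀ r, 0 < r → r ≤ 1 → P (Metric.ball x r) → P (Metric.ball x (2 * r))) {ρ : ℝ}
    (hρ : 0 < ρ) (h : P (Metric.ball x ρ)) {r : ℝ} (hr : r ≤ 2) : P (Metric.ball x r) := by
  have key : ∀ k : ℕ, ∀ s ≤ 2, s ≤ 2 ^ k * ρ → P (Metric.ball x s) := by
    intro k
    induction k with
    | zero => intro s _ hs; exact hmono _ _ (Metric.ball_subset_ball (by simpa using hs)) h
    | succ k ih =>
      intro s hs2 hs
      by_cases h0 : 0 < s
      · have h1 := hstep (s / 2) (by linarith) (by linarith)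
          (ih (s / 2) (by linarith) (by rw [pow_succ] at hs; linarith))
        rwa [mul_div_cancel₀ _ (two_ne_zero)] at h1
      · rw [Metric.ball_eq_empty.2 (not_lt.1 h0)]
        exact hmono _ _ (empty_subset _) h
  obtain ⟨k, hk⟩ := pow_unbounded_of_one_lt (2 / ρ) (one_lt_two)
  refine key k r hr (hr.trans ?_)
  rw [div_lt_iff₀ hρ] at hk
  exact hk.le

/-- If some ball at `p` is null, doubling makes the ball of radius `2` null, hence unit balls at all
points within distance `1` of `p`. The centres of null balls thus form a clopen set; by
connectedness it is empty or everything, and in the latter case the measure would be zero. -/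
theorem localDoubling_of_measure_ne_zero [ConnectedSpace X] [SecondCountableTopology X]
    {μ : Measure X} {C : ℝ} (hC : 1 < C)
    (hVD : ∀ (p : X) (r : ℝ), 0 < r → r ≤ 1 →
      μ (Metric.ball p (2 * r)) ≤ ENNReal.ofReal C * μ (Metric.ball p r))
    (hfin : ∀ x : X, ∃ r > 0, μ (Metric.ball x r) < ⊤) (hμ : μ univ ≠ 0) :
    LocalDoubling μ C := by
  have hfin' : ∀ x r, r ≤ 2 → μ (Metric.ball x r) < ⊤ := by
    intro x r hr
    obtain ⟨ρ, hρ, hlt⟩ := hfin x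
    exact ball_induction (P := fun s => μ s < ⊤) (fun s t hst ht => (measure_mono hst).trans_lt ht)
      (fun s h0 h1 hs => (hVD x s h0 h1).trans_lt (ENNReal.mul_lt_top (by simp) hs)) hρ hlt hr
  have hzero : ∀ x ρ, 0 < ρ → μ (Metric.ball x ρ) = 0 → μ (Metric.ball x 2) = 0 := by
    intro x ρ hρ h0
    refine ball_induction (P := fun s => μ s = 0) (fun s t hst ht => measure_mono_null hst ht)
      (fun s h0 h1 hs => ?_) hρ h0 le_rfl
    have := hVD x s h0 h1
    rwa [hs, mul_zero, nonpos_iff_eq_zero] at this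
  set Z : Set X := {x | ∃ ρ > 0, μ (Metric.ball x ρ) = 0}
  have hZ : ∀ p ∈ Z, ∀ q, dist q p < 1 → q ∈ Z := by
    rintro p ⟨ρ, hρ, h0⟩ q hq
    exact ⟨1, one_pos, measure_mono_null (Metric.ball_subset_ball' (by linarith)) (hzero p ρ hρ h0)⟩
  have hclopen : IsClopen Z := by
    refine ⟨isClosed_of_closure_subset fun p hp => ?_, Metric.isOpen_iff.2 fun p hp =>
      ⟨1, one_pos, fun q hq => hZ p hp q hq⟩⟩
    obtain ⟨q, hq, hpq⟩ := Metric.mem_closure_iff.1 hp 1 one_pos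
    exact hZ q hq p hpq
  have hempty : Z = ∅ := by
    refine (isClopen_iff.1 hclopen).resolve_right fun h => hμ ?_
    refine measure_null_of_locally_null _ fun x _ => ?_
    obtain ⟨ρ, hρ, h0⟩ : x ∈ Z := h ▸ mem_univ x
    exact ⟨_, mem_nhdsWithin_of_mem_nhds (Metric.ball_mem_nhds x hρ), h0⟩
  refine ⟨hC, hfin', fun x r hr => ?_, fun x r h0 h1 => ?_⟩
  · refine pos_iff_ne_zero.2 fun h => ?_
    have : x ∈ Z := ⟨r, hr, h⟩
    rw [hempty] at this
    exact this
  · have := ENNReal.toReal_mono (ENNReal.mul_ne_top ENNReal.ofReal_ne_top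
      (hfin' x r (by linarith)).ne) (hVD x r h0 h1)
    rwa [ENNReal.toReal_mul, ENNReal.toReal_ofReal (by linarith)] at this

namespace LocalDoubling

variable {μ : Measure X} {C : ℝ} (h : LocalDoubling μ C)
include h

theorem real_ball_pos (x : X) {r : ℝ} (h0 : 0 < r) (h2 : r ≤ 2) : 0 < μ.real (Metric.ball x r) :=
  ENNReal.toReal_pos (h.measure_ball_pos x r h0).ne' (h.measure_ball_lt_top x r h2).ne

theorem real_ball_le_pow (k : ℕ) (x : X) {r : ℝ} (h0 : 0 < r) (h2 : r ≤ 2) :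
    μ.real (Metric.ball x r) ≤ C ^ k * μ.real (Metric.ball x (r / 2 ^ k)) := by
  have hC := h.one_lt
  induction k with
  | zero => simp
  | succ k ih =>
    refine ih.trans ?_
    have h1 : r / 2 ^ k = 2 * (r / 2 ^ (k + 1)) := by rw [pow_succ]; field_simp
    have h3 : r / 2 ^ (k + 1) ≤ 1 := by
      rw [div_le_one (by positivity), pow_succ]
      have : (1 : ℝ) ≤ 2 ^ k := one_le_pow₀ one_le_two
      linarith
    rw [h1, pow_succ C, mul_assoc]
    exact mul_le_mul_of_nonneg_left (h.doubling x _ (by positivity) h3) (by positivity)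

theorem real_mono {x y : X} {r s : ℝ} (hs : s ≤ 2) (hxy : r + dist x y ≤ s) :
    μ.real (Metric.ball x r) ≤ μ.real (Metric.ball y s) :=
  measureReal_mono (Metric.ball_subset_ball' hxy) (h.measure_ball_lt_top y s hs).ne

/-- Otherwise there is an infinite `ε`-separated sequence. Balls of radius `2 / 2 ^ k` about its
points are disjoint, lie in the unit ball at `x`, and by doubling each carry at least the fraction
`C⁻ᵏ` of its finite measure. -/
theorem totallyBounded_closedBall (x : X) : TotallyBounded (Metric.closedBall x (1 / 2)) := by
  rw [Metric.totallyBounded_iff]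
  by_contra hcon
  push Not at hcon
  obtain ⟨ε, hε, hcov⟩ := hcon
  obtain ⟨u, hu, husep⟩ := exists_seq_of_forall_finset_exists
    (fun y => y ∈ Metric.closedBall x (1 / 2)) (fun y z => ε ≤ dist y z) (by
      intro s _
      obtain ⟨y, hy, hys⟩ := not_subset.1 (hcov s s.finite_toSet)
      refine ⟨y, hy, fun z hz => ?_⟩
      by_contra hlt
      exact hys (mem_biUnion hz (by rw [Metric.mem_ball, dist_comm]; exact not_le.1 hlt)))
  obtain ⟨k, hk⟩ := pow_unbounded_of_one_lt (2 / min (ε / 2) (1 / 2)) one_lt_two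
  have hm : 0 < min (ε / 2) (1 / 2) := by positivity
  have hk' : 2 / 2 ^ k < min (ε / 2) (1 / 2) := by
    rw [div_lt_iff₀ hm] at hk
    rw [div_lt_iff₀ (by positivity)]
    linarith
  have hC := h.one_lt
  have hδ : 0 < μ.real (Metric.ball x 1) / C ^ k :=
    div_pos (h.real_ball_pos x one_pos one_le_two) (by positivity)
  have hlow : ∀ i, μ.real (Metric.ball x 1) / C ^ k ≤ μ.real (Metric.ball (u i) (2 / 2 ^ k)) := by
    intro i
    rw [div_le_iff₀ (by positivity), mul_comm]
    refine le_trans ?_ (h.real_ball_le_pow k (u i) two_pos le_rfl)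
    refine h.real_mono le_rfl ?_
    have := hu i
    rw [Metric.mem_closedBall, dist_comm] at this
    linarith
  have hsub : ∀ i, Metric.ball (u i) (2 / 2 ^ k) ⊆ Metric.ball x 1 := fun i =>
    Metric.ball_subset_ball' (by
      have := hu i
      rw [Metric.mem_closedBall] at this
      have := hk'.trans_le (min_le_right _ _)
      linarith)
  have hdis : Pairwise (Function.onFun Disjoint fun i => Metric.ball (u i) (2 / 2 ^ k)) := by
    have haux : ∀ i j, i < j → Disjoint (Metric.ball (u i) (2 / 2 ^ k))
        (Metric.ball (u j) (2 / 2 ^ k)) := fun i j hij =>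
      Metric.ball_disjoint_ball (by
        have := husep i j hij
        have := hk'.trans_le (min_le_left _ _)
        linarith)
    intro i j hij
    rcases lt_or_gt_of_ne hij with h' | h'
    · exact haux i j h'
    · exact (haux j i h').symm
  have hfinite := Measure.finite_const_le_meas_of_disjoint_iUnion μ
    (ε := ENNReal.ofReal (μ.real (Metric.ball x 1) / C ^ k)) (ENNReal.ofReal_pos.2 hδ)
    (fun i => (Metric.isOpen_ball (x := u i) (ε := 2 / 2 ^ k)).measurableSet) hdis
    (((measure_mono (iUnion_subset hsub)).trans_lt (h.measure_ball_lt_top x 1 one_le_two)).ne)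
  refine Set.infinite_univ (α := ℕ) (hfinite.subset fun i _ => ?_)
  change ENNReal.ofReal _ ≤ μ _
  rw [ENNReal.ofReal_le_iff_le_toReal
    (h.measure_ball_lt_top _ _ ((hk'.trans_le (min_le_right _ _)).le.trans (by norm_num))).ne]
  exact hlow i

theorem isCompact_closedBall [CompleteSpace X] (x : X) :
    IsCompact (Metric.closedBall x (1 / 2)) :=
  isCompact_iff_totallyBounded_isComplete.2
    ⟨h.totallyBounded_closedBall x, Metric.isClosed_closedBall.isComplete⟩

/-- Confines the support of an average: averaging at scale `1/4` moves it by at most that much, and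
`1/8 + 1/4` is below the radius `1/2` of the compact balls. -/
theorem exists_compact_of_near [CompleteSpace X] {T : Set X} (hT : IsCompact T) :
    ∃ Q : Set X, IsCompact Q ∧ ∀ x, ∀ y ∈ T, dist x y < 1 / 4 → x ∈ Q := by
  obtain ⟨s, hs, hcov⟩ := hT.elim_finite_subcover_image (b := univ)
    (c := fun x => Metric.ball x (1 / 8)) (fun _ _ => Metric.isOpen_ball)
    (fun x _ => mem_biUnion (mem_univ x) (Metric.mem_ball_self (by norm_num)))
  refine ⟨⋃ x ∈ s, Metric.closedBall x (1 / 2), hcov.1.isCompact_biUnion fun x _ =>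
    h.isCompact_closedBall x, fun x y hy hxy => ?_⟩
  obtain ⟨z, hz, hyz⟩ := mem_iUnion₂.1 (hcov.2 hy)
  refine mem_biUnion hz ?_
  rw [Metric.mem_closedBall]
  rw [Metric.mem_ball] at hyz
  linarith [dist_triangle x y z]

theorem isLocallyFiniteMeasure : IsLocallyFiniteMeasure μ :=
  ⟨fun x => ⟨Metric.ball x 1, Metric.ball_mem_nhds x one_pos,
    h.measure_ball_lt_top x 1 one_le_two⟩⟩

/-- Averaging over balls is bounded on nonnegative functions. -/
theorem lintegral_average_le [SecondCountableTopology X] {g : X → ENNReal} (hg : Measurable g) :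
    ∫⁻ x, (∫⁻ y in Metric.ball x (1 / 2), g y ∂μ) / μ (Metric.ball x (1 / 2)) ∂μ ≤
      ENNReal.ofReal C * ∫⁻ y, g y ∂μ := by
  have := h.isLocallyFiniteMeasure
  have hC := h.one_lt
  have hopen : IsOpen {p : X × X | dist p.2 p.1 < 1 / 2} :=
    isOpen_lt (by fun_prop) continuous_const
  have hmeasB : Measurable fun x => μ (Metric.ball x (1 / 2)) :=
    measurable_measure_prodMk_left hopen.measurableSet
  set F : X → X → ENNReal := fun x y =>
    {p : X × X | dist p.2 p.1 < 1 / 2}.indicator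
      (fun p => g p.2 * (μ (Metric.ball p.1 (1 / 2)))⁻¹) (x, y)
  have hF : Measurable (Function.uncurry F) :=
    (((hg.comp measurable_snd).mul (hmeasB.comp measurable_fst).inv).indicator
      hopen.measurableSet)
  have h1 : ∀ x, (∫⁻ y in Metric.ball x (1 / 2), g y ∂μ) / μ (Metric.ball x (1 / 2)) =
      ∫⁻ y, F x y ∂μ := by
    intro x
    rw [div_eq_mul_inv, ← lintegral_mul_const _ hg,
      ← lintegral_indicator Metric.isOpen_ball.measurableSet]
    rfl
  simp only [h1]
  rw [lintegral_lintegral_swap hF.aemeasurable, ← lintegral_const_mul _ hg]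
  refine lintegral_mono fun y => ?_
  -- After Tonelli, `y` is fixed. For `x` within `1/2` of `y` the ball of radius `1/2` at `y` lies
  -- in the unit ball at `x`, so doubling exchanges the two centres at the cost of `C`.
  have h2 : ∀ x, F x y ≤ (Metric.ball y (1 / 2)).indicator
      (fun _ => g y * (ENNReal.ofReal C * (μ (Metric.ball y (1 / 2)))⁻¹)) x := by
    intro x
    by_cases hx : dist y x < 1 / 2
    · have e1 : F x y = g y * (μ (Metric.ball x (1 / 2)))⁻¹ :=
        indicator_of_mem (s := {p : X × X | dist p.2 p.1 < 1 / 2}) (a := (x, y)) hx _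
      rw [e1, indicator_of_mem (by rw [Metric.mem_ball, dist_comm]; exact hx)]
      refine mul_le_mul_right ?_ _
      have e2 : μ.real (Metric.ball y (1 / 2)) ≤ C * μ.real (Metric.ball x (1 / 2)) := by
        have := h.doubling x (1 / 2) (by norm_num) (by norm_num)
        exact (h.real_mono (by norm_num) (by linarith)).trans this
      have e3 : μ (Metric.ball y (1 / 2)) ≤ ENNReal.ofReal C * μ (Metric.ball x (1 / 2)) := by
        rw [← ENNReal.ofReal_toReal (h.measure_ball_lt_top y (1 / 2) (by norm_num)).ne,
          ← ENNReal.ofReal_toReal (h.measure_ball_lt_top x (1 / 2) (by norm_num)).ne,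
          ← ENNReal.ofReal_mul (by linarith)]
        exact ENNReal.ofReal_le_ofReal e2
      rw [ENNReal.inv_le_iff_inv_le,
        ENNReal.mul_inv (by simp [zero_lt_one.trans hC]) (by simp), inv_inv]
      rw [mul_comm, ← div_eq_mul_inv]
      exact ENNReal.div_le_of_le_mul' e3
    · have e1 : F x y = 0 :=
        indicator_of_notMem (s := {p : X × X | dist p.2 p.1 < 1 / 2}) (a := (x, y)) hx _
      rw [e1]; exact zero_le
  refine (lintegral_mono h2).trans ?_
  rw [lintegral_indicator Metric.isOpen_ball.measurableSet, setLIntegral_const]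
  rw [mul_assoc, mul_assoc, ENNReal.inv_mul_cancel (h.measure_ball_pos y _ (by norm_num)).ne'
    (h.measure_ball_lt_top y _ (by norm_num)).ne, mul_one, mul_comm]

end LocalDoubling

end Doubling

/-! ### Elementary bounds for the area integrand. -/

section AreaIntegrand

theorem areaIntegrand_nonneg (g : ℝ) : 0 ≤ √(1 + g ^ 2) - 1 := by
  have : 1 ≤ √(1 + g ^ 2) := Real.one_le_sqrt.2 (by nlinarith [sq_nonneg g])
  linarith

theorem areaIntegrand_le_sq (g : ℝ) : √(1 + g ^ 2) - 1 ≤ g ^ 2 := by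
  have h1 : √(1 + g ^ 2) ≤ 1 + g ^ 2 :=
    Real.sqrt_le_iff.2 ⟨by positivity, by nlinarith [sq_nonneg g]⟩
  linarith

/-- Only `g > ε` matters. With `q = √(1 + g²)`, `g² = (q - 1)(q + 1) ≤ (q - 1)(2 + g)`, while `ε (2
+ g) ≤ 3 g`; together `ε g ≤ 3 (q - 1)`. -/
theorem le_add_areaIntegrand_div {g ε : ℝ} (hε : 0 < ε) (hε1 : ε ≤ 1) :
    g ≤ ε + 3 / ε * (√(1 + g ^ 2) - 1) := by
  have h0 := areaIntegrand_nonneg g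
  rcases le_or_gt g ε with h | h
  · have : 0 ≤ 3 / ε * (√(1 + g ^ 2) - 1) := by positivity
    linarith
  · set q := √(1 + g ^ 2)
    have hq : q * q = 1 + g ^ 2 := Real.mul_self_sqrt (by positivity)
    have hg : 0 < g := hε.trans h
    have hq1 : q ≤ 1 + g := by
      refine Real.sqrt_le_iff.2 ⟨by positivity, by nlinarith⟩
    have h1 : g ^ 2 ≤ (q - 1) * (2 + g) := by nlinarith
    have h2 : ε * (2 + g) ≤ 3 * g := by nlinarith
    have h3 : ε * g ≤ 3 * (q - 1) := by
      have h4 : ε * g * (2 + g) ≤ 3 * (q - 1) * (2 + g) := by nlinarith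
      exact le_of_mul_le_mul_right h4 (by positivity)
    have h5 : g ≤ 3 / ε * (q - 1) := by
      rw [div_mul_eq_mul_div, le_div_iff₀ hε]; linarith
    linarith

/-- Optimization over `ε` in the family of affine bounds. -/
theorem sq_min_le {s a t N : ℝ} (hs : 0 ≤ s) (ha : 0 ≤ a) (ht : 0 ≤ t) (hN : 0 ≤ N)
    (h : ∀ ε, 0 < ε → ε ≤ 1 → s ≤ ε + 3 / ε * a) :
    (min t (N * s)) ^ 2 ≤ max (t ^ 2) (16 * N ^ 2) * a := by
  have hmin : 0 ≤ min t (N * s) := le_min ht (by positivity)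
  -- For `0 < a ≤ 1` take `ε = √a`, giving `s ≤ 4 √a`; for `a = 0` let `ε` tend to `0`. For `a > 1`
  -- the cap `t` suffices.
  rcases le_or_gt a 1 with h1 | h1
  · have hs4 : s ≤ 4 * √a := by
      rcases ha.eq_or_lt with h0 | h0
      · rw [← h0, Real.sqrt_zero, mul_zero]
        refine le_of_forall_pos_le_add fun ε hε => ?_
        have := h (min ε 1) (by positivity) (min_le_right _ _)
        rw [← h0, mul_zero, add_zero] at this
        rw [zero_add]
        exact this.trans (min_le_left _ _)
      · have hsq : 0 < √a := Real.sqrt_pos.2 h0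
        have h2 := h (√a) hsq (Real.sqrt_le_one.2 h1)
        have h3 : 3 / √a * a = 3 * √a := by
          rw [div_mul_eq_mul_div, div_eq_iff hsq.ne', mul_assoc, Real.mul_self_sqrt ha]
        linarith
    have h2 : min t (N * s) ≤ N * (4 * √a) :=
      (min_le_right _ _).trans (mul_le_mul_of_nonneg_left hs4 hN)
    calc (min t (N * s)) ^ 2 ≤ (N * (4 * √a)) ^ 2 := pow_le_pow_left₀ hmin h2 2
      _ = 16 * N ^ 2 * a := by rw [mul_pow, mul_pow, Real.sq_sqrt ha]; ring
      _ ≤ _ := mul_le_mul_of_nonneg_right (le_max_right _ _) ha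
  · calc (min t (N * s)) ^ 2 ≤ t ^ 2 := pow_le_pow_left₀ hmin (min_le_left _ _) 2
      _ = t ^ 2 * 1 := (mul_one _).symm
      _ ≤ t ^ 2 * a := mul_le_mul_of_nonneg_left h1.le (by positivity)
      _ ≤ _ := mul_le_mul_of_nonneg_right (le_max_left _ _) ha

end AreaIntegrand

/-! ### Averaging against the tent kernel. -/

section Smoothing

variable {X : Type*} [MetricSpace X] [MeasurableSpace X] [BorelSpace X]

/-- The averaging kernel. -/
noncomputable def tent (x y : X) : ℝ := max 0 (1 - 4 * dist x y)

theorem tent_nonneg (x y : X) : 0 ≤ tent x y := le_max_left _ _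

theorem tent_le_one (x y : X) : tent x y ≤ 1 :=
  max_le zero_le_one (by linarith [dist_nonneg (x := x) (y := y)])

theorem tent_eq_zero {x y : X} (h : 1 / 4 ≤ dist x y) : tent x y = 0 :=
  max_eq_left (by linarith)

theorem continuous_tent (x : X) : Continuous (tent x) := by
  unfold tent; fun_prop

theorem abs_tent_sub_le (x x' y : X) : |tent x' y - tent x y| ≤ 4 * dist x x' := by
  unfold tent
  refine (abs_max_sub_max_le_max _ _ _ _).trans (max_le (by simp) ?_)
  have : 1 - 4 * dist x' y - (1 - 4 * dist x y) = 4 * (dist x y - dist x' y) := by ring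
  rw [this, abs_mul, abs_of_pos (by norm_num : (0 : ℝ) < 4)]
  exact mul_le_mul_of_nonneg_left (abs_dist_sub_le x x' y) (by norm_num)

theorem abs_integral_le_of_abs_le_indicator {μ : Measure X} {B : Set X} (hB : MeasurableSet B)
    {u f : X → ℝ} {a : ℝ} (hu : IntegrableOn u B μ)
    (hf : ∀ y, |f y| ≤ B.indicator (fun y => a * |u y|) y) :
    |∫ y, f y ∂μ| ≤ a * ∫ y in B, |u y| ∂μ := by
  have h1 : Integrable (B.indicator (fun y => a * |u y|)) μ :=
    (integrable_indicator_iff hB).2 (hu.abs.const_mul a)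
  have h2 := norm_integral_le_of_norm_le (f := f) h1 (ae_of_all μ hf)
  rwa [integral_indicator hB, integral_const_mul] at h2

/-- The average of `φ` against the tent kernel at scale `1 / 4`. -/
noncomputable def smoothing (μ : Measure X) (φ : X → ℝ) (x : X) : ℝ :=
  (∫ y, tent x y * φ y ∂μ) / ∫ y, tent x y ∂μ

namespace LocalDoubling

variable {μ : Measure X} {C : ℝ} (h : LocalDoubling μ C)
include h

theorem integrable_tent_mul {u : X → ℝ} (hu : Continuous u) {b : ℝ} (hb : ∀ y, |u y| ≤ b) (x : X) :
    Integrable (fun y => tent x y * u y) μ := by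
  refine (integrableOn_iff_integrable_of_support_subset (s := Metric.ball x (1 / 4)) ?_).1 ?_
  · intro y hy
    by_contra hcon
    rw [Metric.mem_ball, dist_comm, not_lt] at hcon
    simp [tent_eq_zero hcon] at hy
  · refine IntegrableOn.of_bound (h.measure_ball_lt_top x _ (by norm_num))
      ((continuous_tent x).mul hu).aestronglyMeasurable b (ae_of_all _ fun y => ?_)
    rw [Real.norm_eq_abs, abs_mul, abs_of_nonneg (tent_nonneg _ _)]
    exact (mul_le_of_le_one_left (abs_nonneg _) (tent_le_one _ _)).trans (hb y)

theorem integrable_tent (x : X) : Integrable (tent x) μ := by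
  simpa using h.integrable_tent_mul (u := fun _ => 1) continuous_const (b := 1) (by simp) x

theorem integrableOn_ball {u : X → ℝ} (hu : Continuous u) {b : ℝ} (hb : ∀ y, |u y| ≤ b) (x : X)
    {r : ℝ} (hr : r ≤ 2) : IntegrableOn u (Metric.ball x r) μ :=
  IntegrableOn.of_bound (h.measure_ball_lt_top x _ hr) hu.aestronglyMeasurable b
    (ae_of_all _ hb)

theorem ball_le_weight (x : X) : μ.real (Metric.ball x (1 / 8)) ≤ 2 * ∫ y, tent x y ∂μ := by
  have hB := (Metric.isOpen_ball (x := x) (ε := 1 / 8)).measurableSet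
  have h1 : Integrable ((Metric.ball x (1 / 8)).indicator fun _ => (1 / 2 : ℝ)) μ :=
    (integrable_indicator_iff hB).2
      (integrableOn_const (h.measure_ball_lt_top x _ (by norm_num)).ne)
  have h2 := integral_mono h1 (h.integrable_tent x) fun y => by
    by_cases hy : y ∈ Metric.ball x (1 / 8)
    · rw [indicator_of_mem hy]
      rw [Metric.mem_ball, dist_comm] at hy
      exact le_max_of_le_right (by linarith)
    · rw [indicator_of_notMem hy]
      exact tent_nonneg _ _
  rw [integral_indicator hB, setIntegral_const, smul_eq_mul] at h2
  linarith

theorem weight_pos (x : X) : 0 < ∫ y, tent x y ∂μ := by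
  have := h.ball_le_weight x
  have := h.real_ball_pos x (r := 1 / 8) (by norm_num) (by norm_num)
  linarith

/-- The ball at `x` lies in the unit ball at `z`, and three halvings lead to radius `1/8`, where the
tent is at least `1/2`. -/
theorem ball_le_weight' {x z : X} (hxz : dist x z < 1 / 4) :
    μ.real (Metric.ball x (1 / 2)) ≤ 2 * C ^ 3 * ∫ y, tent z y ∂μ := by
  have hC := h.one_lt
  have h1 := h.ball_le_weight z
  have h2 := h.real_ball_le_pow 3 z (r := 1) one_pos one_le_two
  have h3 : μ.real (Metric.ball x (1 / 2)) ≤ μ.real (Metric.ball z 1) :=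
    h.real_mono one_le_two (by linarith)
  have h4 : (1 : ℝ) / 2 ^ 3 = 1 / 8 := by norm_num
  rw [h4] at h2
  calc _ ≤ C ^ 3 * μ.real (Metric.ball z (1 / 8)) := h3.trans h2
    _ ≤ C ^ 3 * (2 * ∫ y, tent z y ∂μ) := mul_le_mul_of_nonneg_left h1 (by positivity)
    _ = _ := by ring

/-- The kernel is normalized, so constants are preserved; this is what lets the oscillation `φ - c`
replace `φ`. -/
theorem smoothing_sub {φ : X → ℝ} (hφ : Continuous φ) {t : ℝ} (hφ0 : ∀ x, 0 ≤ φ x)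
    (hφt : ∀ x, φ x ≤ t) (c : ℝ) (x : X) :
    smoothing μ φ x - c = (∫ y, tent x y * (φ y - c) ∂μ) / ∫ y, tent x y ∂μ := by
  have h1 : ∫ y, tent x y * (φ y - c) ∂μ =
      (∫ y, tent x y * φ y ∂μ) - (∫ y, tent x y ∂μ) * c := by
    rw [← integral_mul_const, ← integral_sub
      (h.integrable_tent_mul hφ (b := t) (fun y => by rw [abs_of_nonneg (hφ0 y)]; exact hφt y) x)
      ((h.integrable_tent x).mul_const c)]
    simp only [mul_sub]
  rw [h1, smoothing, sub_div, mul_div_cancel_left₀ _ (h.weight_pos x).ne']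

theorem smoothing_nonneg {φ : X → ℝ} (hφ0 : ∀ x, 0 ≤ φ x) (x : X) : 0 ≤ smoothing μ φ x :=
  div_nonneg (integral_nonneg fun y => mul_nonneg (tent_nonneg _ _) (hφ0 y)) (h.weight_pos x).le

theorem abs_tent_integral_le {u : X → ℝ} (hu : Continuous u) {b : ℝ} (hb : ∀ y, |u y| ≤ b)
    {x z : X} (hxz : dist x z ≤ 1 / 4) :
    |∫ y, tent z y * u y ∂μ| ≤ ∫ y in Metric.ball x (1 / 2), |u y| ∂μ := by
  have h1 := abs_integral_le_of_abs_le_indicator (a := 1) (f := fun y => tent z y * u y)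
    Metric.isOpen_ball.measurableSet (h.integrableOn_ball hu hb x (r := 1 / 2) (by norm_num)) ?_
  · rwa [one_mul] at h1
  · intro y
    by_cases hy : y ∈ Metric.ball x (1 / 2)
    · rw [indicator_of_mem hy, abs_mul, abs_of_nonneg (tent_nonneg _ _)]
      exact mul_le_mul_of_nonneg_right (tent_le_one _ _) (abs_nonneg _)
    · rw [indicator_of_notMem hy, tent_eq_zero]
      · simp
      · rw [Metric.mem_ball, dist_comm, not_lt] at hy
        linarith [dist_triangle x z y]

/-- The averaged function is Lipschitz with a constant controlled by the mean oscillation. -/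
theorem abs_smoothing_sub_le {φ : X → ℝ} (hφ : Continuous φ) {t : ℝ} (hφ0 : ∀ x, 0 ≤ φ x)
    (hφt : ∀ x, φ x ≤ t) (c : ℝ) {x z : X} (hxz : dist x z < 1 / 4) :
    |smoothing μ φ z - smoothing μ φ x| ≤ 8 * C ^ 3 * (1 + 2 * C ^ 3) *
      ((∫ y in Metric.ball x (1 / 2), |φ y - c| ∂μ) / μ.real (Metric.ball x (1 / 2))) *
      dist x z := by
  have hC := h.one_lt
  have hu : Continuous fun y => φ y - c := by fun_prop
  have hb : ∀ y, |φ y - c| ≤ t + |c| := fun y => by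
    refine (abs_sub _ _).trans ?_
    rw [abs_of_nonneg (hφ0 y)]
    linarith [hφt y]
  have hBm := (Metric.isOpen_ball (x := x) (ε := 1 / 2)).measurableSet
  have hout : ∀ y, y ∉ Metric.ball x (1 / 2) → tent z y - tent x y = 0 := by
    intro y hy
    rw [Metric.mem_ball, dist_comm, not_lt] at hy
    rw [tent_eq_zero (x := x) (by linarith), tent_eq_zero (by linarith [dist_triangle x z y]),
      sub_zero]
  set I := ∫ y in Metric.ball x (1 / 2), |φ y - c| ∂μ
  set m := μ.real (Metric.ball x (1 / 2))
  set d := dist x z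
  set wx := ∫ y, tent x y ∂μ
  set wz := ∫ y, tent z y ∂μ
  set Fx := ∫ y, tent x y * (φ y - c) ∂μ
  set Fz := ∫ y, tent z y * (φ y - c) ∂μ
  have hI : 0 ≤ I := integral_nonneg fun y => abs_nonneg _
  have hd : 0 ≤ d := dist_nonneg
  have hm : 0 < m := h.real_ball_pos x (by norm_num) (by norm_num)
  have hwx : 0 < wx := h.weight_pos x
  have hwz : 0 < wz := h.weight_pos z
  have hmx : m ≤ 2 * C ^ 3 * wx := h.ball_le_weight' (by rw [dist_self]; norm_num)
  have hmz : m ≤ 2 * C ^ 3 * wz := h.ball_le_weight' hxz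
  have e1 : |Fz - Fx| ≤ 4 * d * I := by
    rw [← integral_sub (h.integrable_tent_mul hu hb z) (h.integrable_tent_mul hu hb x)]
    refine abs_integral_le_of_abs_le_indicator hBm
      (h.integrableOn_ball hu hb x (by norm_num)) fun y => ?_
    rw [← sub_mul, abs_mul]
    by_cases hy : y ∈ Metric.ball x (1 / 2)
    · rw [indicator_of_mem hy]
      exact mul_le_mul_of_nonneg_right (abs_tent_sub_le x z y) (abs_nonneg _)
    · rw [indicator_of_notMem hy, hout y hy]
      simp
  have e2 : |wz - wx| ≤ 4 * d * m := by
    rw [← integral_sub (h.integrable_tent z) (h.integrable_tent x)]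
    have := abs_integral_le_of_abs_le_indicator (a := 4 * d) (u := fun _ => 1)
      (f := fun y => tent z y - tent x y) hBm
      (h.integrableOn_ball continuous_const (b := 1) (by simp) x (by norm_num)) fun y => ?_
    · simpa [m] using this
    · by_cases hy : y ∈ Metric.ball x (1 / 2)
      · rw [indicator_of_mem hy]
        simpa using abs_tent_sub_le x z y
      · rw [indicator_of_notMem hy, hout y hy]
        simp
  have e3 : |Fz| ≤ I := h.abs_tent_integral_le hu hb hxz.le
  -- This splitting separates the change of the numerator from the change of the weight; each is of
  -- order `dist x z` because the tent is `4`-Lipschitz.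
  have e4 : smoothing μ φ z - smoothing μ φ x =
      (Fz - Fx) / wx - Fz * (wz - wx) / (wz * wx) := by
    have := h.smoothing_sub hφ hφ0 hφt c z
    have := h.smoothing_sub hφ hφ0 hφt c x
    have : smoothing μ φ z - smoothing μ φ x = Fz / wz - Fx / wx := by linarith
    rw [this]
    field_simp
    ring
  have hP : 0 < C ^ 3 := by positivity
  have hwx' : 1 / wx ≤ 2 * C ^ 3 / m := by
    rw [div_le_div_iff₀ hwx hm]; linarith
  have hwz' : m / wz ≤ 2 * C ^ 3 := by
    rw [div_le_iff₀ hwz]; linarith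
  have e5 : |(Fz - Fx) / wx| ≤ 4 * d * I * (2 * C ^ 3 / m) := by
    rw [abs_div, abs_of_pos hwx, div_eq_mul_one_div]
    exact mul_le_mul e1 hwx' (by positivity) (by positivity)
  have e6 : |Fz * (wz - wx) / (wz * wx)| ≤ I * (4 * d * (2 * C ^ 3)) * (2 * C ^ 3 / m) := by
    have e7 : Fz * (wz - wx) / (wz * wx) = Fz * ((wz - wx) / wz) * (1 / wx) := by
      field_simp
    have e8 : |(wz - wx) / wz| ≤ 4 * d * (2 * C ^ 3) := by
      rw [abs_div, abs_of_pos hwz]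
      calc |wz - wx| / wz ≤ 4 * d * m / wz := div_le_div_of_nonneg_right e2 hwz.le
        _ = 4 * d * (m / wz) := by ring
        _ ≤ _ := mul_le_mul_of_nonneg_left hwz' (by positivity)
    rw [e7, abs_mul, abs_mul, abs_of_pos (by positivity : 0 < 1 / wx)]
    exact mul_le_mul (mul_le_mul e3 e8 (abs_nonneg _) hI) hwx' (by positivity) (by positivity)
  rw [e4]
  refine (abs_sub _ _).trans ((add_le_add e5 e6).trans (le_of_eq ?_))
  field_simp
  ring

/-- The case `c = 0`, where the mean is at most `t`. It needs no Poincaré inequality and covers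
balls of large energy. -/
theorem abs_smoothing_sub_le_mul_dist {φ : X → ℝ} (hφ : Continuous φ) {t : ℝ} (hφ0 : ∀ x, 0 ≤ φ x)
    (hφt : ∀ x, φ x ≤ t) {x z : X} (hxz : dist x z < 1 / 4) :
    |smoothing μ φ z - smoothing μ φ x| ≤ 8 * C ^ 3 * (1 + 2 * C ^ 3) * t * dist x z := by
  have hC := h.one_lt
  refine (h.abs_smoothing_sub_le hφ hφ0 hφt 0 hxz).trans ?_
  refine mul_le_mul_of_nonneg_right (mul_le_mul_of_nonneg_left ?_ (by positivity)) dist_nonneg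
  have hm : 0 < μ.real (Metric.ball x (1 / 2)) := h.real_ball_pos x (by norm_num) (by norm_num)
  rw [div_le_iff₀ hm]
  have hb : ∀ y, |φ y| ≤ t := fun y => by rw [abs_of_nonneg (hφ0 y)]; exact hφt y
  calc ∫ y in Metric.ball x (1 / 2), |φ y - 0| ∂μ
      ≤ ∫ y in Metric.ball x (1 / 2), t ∂μ := by
        refine integral_mono ?_ (integrableOn_const
          (h.measure_ball_lt_top x _ (by norm_num)).ne) fun y => by simpa using hb y
        simpa using (h.integrableOn_ball hφ hb x (r := 1 / 2) (by norm_num)).abs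
    _ = _ := by rw [setIntegral_const, smul_eq_mul, mul_comm]

end LocalDoubling

end Smoothing

/-! ### Energy estimates for the average under a Poincaré inequality. -/

namespace LocalDoubling

variable {X : Type*} [MetricSpace X] [MeasurableSpace X] [BorelSpace X]
  {μ : Measure X} {C : ℝ} (h : LocalDoubling μ C) {g : X → ℝ}
include h

theorem integrableOn_of_areaIntegrand (hg : Measurable g) (hg0 : ∀ x, 0 ≤ g x)
    (hint : Integrable (fun x => √(1 + g x ^ 2) - 1) μ) (x : X) :
    IntegrableOn g (Metric.ball x (1 / 2)) μ := by
  have h1 : IntegrableOn (fun y => 1 + 3 / 1 * (√(1 + g y ^ 2) - 1)) (Metric.ball x (1 / 2)) μ :=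
    (integrableOn_const (h.measure_ball_lt_top x _ (by norm_num)).ne).add
      (hint.integrableOn.const_mul _)
  refine h1.mono' hg.aestronglyMeasurable (ae_of_all _ fun y => ?_)
  rw [Real.norm_eq_abs, abs_of_nonneg (hg0 y)]
  exact le_add_areaIntegrand_div one_pos le_rfl

theorem integral_ball_le_add (hg : Measurable g) (hg0 : ∀ x, 0 ≤ g x)
    (hint : Integrable (fun x => √(1 + g x ^ 2) - 1) μ) (x : X) {ε : ℝ} (hε : 0 < ε)
    (hε1 : ε ≤ 1) :
    ∫ y in Metric.ball x (1 / 2), g y ∂μ ≤ ε * μ.real (Metric.ball x (1 / 2)) +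
      3 / ε * ∫ y in Metric.ball x (1 / 2), (√(1 + g y ^ 2) - 1) ∂μ := by
  have hc : IntegrableOn (fun _ => ε) (Metric.ball x (1 / 2)) μ :=
    integrableOn_const (h.measure_ball_lt_top x _ (by norm_num)).ne
  have h1 := integral_mono (h.integrableOn_of_areaIntegrand hg hg0 hint x)
    (hc.add (hint.integrableOn.const_mul (3 / ε))) fun y =>
      le_add_areaIntegrand_div (g := g y) hε hε1
  refine h1.trans (le_of_eq ?_)
  simp only [Pi.add_apply]
  rw [integral_add hc (hint.integrableOn.const_mul (3 / ε)), setIntegral_const,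
    integral_const_mul, smul_eq_mul, mul_comm]

/-- Under the Poincaré inequality, the squared Lipschitz constant of the averaged function is
controlled by the mean of the area integrand. -/
theorem exists_lipschitz_smoothing (hg : Measurable g) (hg0 : ∀ x, 0 ≤ g x)
    (hint : Integrable (fun x => √(1 + g x ^ 2) - 1) μ) {φ : X → ℝ} (hφ : Continuous φ) {t : ℝ}
    (hφ0 : ∀ x, 0 ≤ φ x) (hφt : ∀ x, φ x ≤ t) {N : ℝ} (hN : 0 ≤ N) {x : X}
    (hP : ∃ c, ∫ y in Metric.ball x (1 / 2), |φ y - c| ∂μ ≤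
      N * ∫ y in Metric.ball x (1 / 2), g y ∂μ) :
    ∃ L, 0 ≤ L ∧ (∀ z, dist x z < 1 / 4 → |smoothing μ φ z - smoothing μ φ x| ≤ L * dist x z) ∧
      L ^ 2 ≤ (8 * C ^ 3 * (1 + 2 * C ^ 3)) ^ 2 * max (t ^ 2) (16 * N ^ 2) *
        ((∫ y in Metric.ball x (1 / 2), (√(1 + g y ^ 2) - 1) ∂μ) /
          μ.real (Metric.ball x (1 / 2))) := by
  have hC := h.one_lt
  obtain ⟨c, hc⟩ := hP
  have ht : 0 ≤ t := (hφ0 x).trans (hφt x)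
  have hm : 0 < μ.real (Metric.ball x (1 / 2)) := h.real_ball_pos x (by norm_num) (by norm_num)
  set A := 8 * C ^ 3 * (1 + 2 * C ^ 3)
  have hA : 0 ≤ A := by positivity
  set m := μ.real (Metric.ball x (1 / 2))
  set s := (∫ y in Metric.ball x (1 / 2), g y ∂μ) / m
  have hs : 0 ≤ s := div_nonneg (integral_nonneg hg0) hm.le
  refine ⟨A * min t (N * s), mul_nonneg hA (le_min ht (by positivity)), fun z hz => ?_, ?_⟩
  · rcases min_choice t (N * s) with h1 | h1
    · rw [h1]
      exact h.abs_smoothing_sub_le_mul_dist hφ hφ0 hφt hz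
    · rw [h1]
      refine (h.abs_smoothing_sub_le hφ hφ0 hφt c hz).trans ?_
      refine mul_le_mul_of_nonneg_right (mul_le_mul_of_nonneg_left ?_ hA) dist_nonneg
      rw [← mul_div_assoc]
      exact div_le_div_of_nonneg_right hc hm.le
  · rw [mul_pow, mul_assoc]
    refine mul_le_mul_of_nonneg_left (sq_min_le hs (div_nonneg (integral_nonneg fun y =>
      areaIntegrand_nonneg _) hm.le) ht hN fun ε hε hε1 => ?_) (by positivity)
    rw [div_le_iff₀ hm, add_mul, mul_assoc, div_mul_cancel₀ _ hm.ne']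
    exact h.integral_ball_le_add hg hg0 hint x hε hε1

/-- If a function equal to its maximum `t` on `K` has small energy, then its average is at least
`t / 2` close to a point of density of `K`. -/
theorem exists_energy_threshold {K : Set X} (hK : MeasurableSet K) {p : X}
    (hKp : 0 < μ (K ∩ Metric.ball p (1 / 2))) {t : ℝ} (ht : 0 < t) {N : ℝ} (hN : 0 ≤ N) :
    ∃ E > 0, ∀ φ g : X → ℝ, Continuous φ → (∀ x, 0 ≤ φ x) → (∀ x, φ x ≤ t) → (∀ x ∈ K, φ x = t) →
      Measurable g → (∀ x, 0 ≤ g x) → Integrable (fun x => √(1 + g x ^ 2) - 1) μ →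
      ∫ x, (√(1 + g x ^ 2) - 1) ∂μ ≤ E →
      (∃ c, ∫ y in Metric.ball p (1 / 2), |φ y - c| ∂μ ≤
        N * ∫ y in Metric.ball p (1 / 2), g y ∂μ) →
      ∀ x ∈ Metric.closedBall p (1 / 8), t / 2 ≤ smoothing μ φ x := by
  have hC := h.one_lt
  set B := Metric.ball p (1 / 2)
  have hBm : MeasurableSet B := Metric.isOpen_ball.measurableSet
  set m := μ.real B
  have hm : 0 < m := h.real_ball_pos p (by norm_num) (by norm_num)
  have hBfin : μ B < ⊤ := h.measure_ball_lt_top p _ (by norm_num)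
  have hKfin : μ (K ∩ B) ≠ ⊤ := ((measure_mono inter_subset_right).trans_lt hBfin).ne
  set κ := μ.real (K ∩ B)
  have hκ : 0 < κ := ENNReal.toReal_pos hKp.ne' hKfin
  -- With `I` the integral of `|φ - c|` over `B`, the two summands times `I` bound `|S x - c|` and
  -- `|t - c|`, so `I * Q ≤ t / 2` is the goal.
  set Q := 2 * C ^ 3 / m + 1 / κ
  have hQ : 0 < Q := by positivity
  -- `ε` and the threshold below make each term of `integral_ball_le_add` at most `t / (4 (N + 1)
  -- Q)`; `N + 1` avoids dividing by `N = 0`.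
  set ε := min 1 (t / (4 * (N + 1) * m * Q))
  have hε : 0 < ε := by positivity
  have hε1 : ε ≤ 1 := min_le_left _ _
  refine ⟨t * ε / (12 * (N + 1) * Q), by positivity, ?_⟩
  intro φ g hφ hφ0 hφt hφK hg hg0 hint hE ⟨c, hc⟩ x hx
  have hu : Continuous fun y => φ y - c := by fun_prop
  have hb : ∀ y, |φ y - c| ≤ t + |c| := fun y => by
    refine (abs_sub _ _).trans ?_
    rw [abs_of_nonneg (hφ0 y)]
    linarith [hφt y]
  set I := ∫ y in B, |φ y - c| ∂μ
  have hI0 : 0 ≤ I := integral_nonneg fun y => abs_nonneg _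
  have hxp : dist p x ≤ 1 / 8 := by rw [dist_comm]; exact hx
  have hIQ : I * Q ≤ t / 2 := by
    have h1 := h.integral_ball_le_add hg hg0 hint p hε hε1
    have h2 : ∫ y in B, (√(1 + g y ^ 2) - 1) ∂μ ≤ t * ε / (12 * (N + 1) * Q) :=
      (setIntegral_le_integral hint (ae_of_all _ fun y => areaIntegrand_nonneg _)).trans hE
    have h3 : ε * m ≤ t / (4 * (N + 1) * Q) := by
      calc ε * m ≤ t / (4 * (N + 1) * m * Q) * m :=
            mul_le_mul_of_nonneg_right (min_le_right _ _) hm.le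
        _ = _ := by field_simp
    have h4 : 3 / ε * ∫ y in B, (√(1 + g y ^ 2) - 1) ∂μ ≤ t / (4 * (N + 1) * Q) := by
      refine (mul_le_mul_of_nonneg_left h2 (by positivity)).trans (le_of_eq ?_)
      field_simp
      norm_num
    have h5 : I ≤ (N + 1) * (t / (4 * (N + 1) * Q) + t / (4 * (N + 1) * Q)) := by
      refine hc.trans (mul_le_mul (by linarith) (by linarith) (integral_nonneg hg0) (by linarith))
    calc I * Q ≤ (N + 1) * (t / (4 * (N + 1) * Q) + t / (4 * (N + 1) * Q)) * Q :=
          mul_le_mul_of_nonneg_right h5 hQ.le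
      _ = t / 2 := by field_simp; norm_num
  have h1 : |smoothing μ φ x - c| ≤ I * (2 * C ^ 3 / m) := by
    rw [h.smoothing_sub hφ hφ0 hφt, abs_div, abs_of_pos (h.weight_pos x), div_eq_mul_one_div]
    refine mul_le_mul (h.abs_tent_integral_le hu hb (by linarith)) ?_
      (one_div_nonneg.2 (h.weight_pos x).le) hI0
    rw [div_le_div_iff₀ (h.weight_pos x) hm, one_mul]
    exact h.ball_le_weight' (by linarith)
  have h2 : |t - c| ≤ I * (1 / κ) := by
    rw [mul_one_div, le_div_iff₀ hκ]
    have h3 : ∫ y in K ∩ B, |φ y - c| ∂μ = |t - c| * κ := by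
      rw [setIntegral_congr_fun (g := fun _ => |t - c|) (hK.inter hBm)
        fun y hy => by simp only [hφK y hy.1], setIntegral_const, smul_eq_mul, mul_comm]
    rw [← h3]
    exact setIntegral_mono_set (h.integrableOn_ball hu hb p (by norm_num)).abs
      (ae_of_all _ fun y => abs_nonneg _) inter_subset_right.eventuallyLE
  have h3 : I * Q = I * (2 * C ^ 3 / m) + I * (1 / κ) := mul_add _ _ _
  have := abs_le.1 h1
  have := abs_le.1 h2
  linarith

end LocalDoubling

/-! ### The two implications. -/

section Manifold

variable {n : ℕ} {M : Type*} [MetricSpace M] [ConnectedSpace M]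
    [SecondCountableTopology M] [ChartedSpace (EuclideanSpace ℝ (Fin n)) M] [IsManifold (𝓡 n) ∞ M]
    [Bundle.RiemannianBundle (fun x : M => TangentSpace (𝓡 n) x)]
    [IsContMDiffRiemannianBundle (𝓡 n) ∞ (EuclideanSpace ℝ (Fin n))
      (fun x : M => TangentSpace (𝓡 n) x)]
    [IsRiemannianManifold (𝓡 n) M] [CompleteSpace M]
    [MeasurableSpace M] [BorelSpace M]

theorem isMParabolic_of_isParabolic (hp : IsParabolic n M) : IsMParabolic n M := by
  obtain ⟨K, hK, hKpos, hcap⟩ := hp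
  refine ⟨1, one_pos, K, hK, hKpos, ?_⟩
  rw [← nonpos_iff_eq_zero, ← hcap]
  exact iInf₂_mono fun φ _ => lintegral_mono fun x =>
    ENNReal.ofReal_le_ofReal (areaIntegrand_le_sq _)

/-- Puts the hypothesis at radius `1/2` into real-valued form, with `c` the mean of `φ`. Finite area
energy makes the gradient integrable on the ball, so `φ` is Sobolev there. -/
theorem exists_poincare_of_locallyLipschitz {C D : ℝ}
    (h : LocalDoubling (μHE[n] : Measure M) D) (hC : 1 ≤ C)
    (hNP : ∀ (p : M) (r : ℝ), 0 < r → r ≤ 1 →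
      ∀ (f : M → ℝ) (θ : ∀ x : M, TangentSpace (𝓡 n) x →L[ℝ] ℝ),
        IsSobolevOneOne n (Metric.ball p r) f θ →
        ∫⁻ x in Metric.ball p r,
          ENNReal.ofReal |f x - ⨍ y in Metric.ball p r, f y ∂μHE[n]| ∂μHE[n] ≤
        ENNReal.ofReal (C * r) * ∫⁻ x in Metric.ball p r, ENNReal.ofReal ‖θ x‖ ∂μHE[n])
    {φ : M → ℝ} (hφ : LocallyLipschitz φ) {t : ℝ} (hφ0 : ∀ x, 0 ≤ φ x) (hφt : ∀ x, φ x ≤ t)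
    (hint : Integrable (fun x => √(1 + gradNorm n φ x ^ 2) - 1) μHE[n]) (x : M) :
    ∃ c, ∫ y in Metric.ball x (1 / 2), |φ y - c| ∂μHE[n] ≤
      C / 2 * ∫ y in Metric.ball x (1 / 2), gradNorm n φ y ∂μHE[n] := by
  have hgi := h.integrableOn_of_areaIntegrand (measurable_gradNorm φ) (gradNorm_nonneg φ) hint x
  have hφi : IntegrableOn φ (Metric.ball x (1 / 2)) μHE[n] :=
    h.integrableOn_ball hφ.continuous (b := t)
      (fun y => by rw [abs_of_nonneg (hφ0 y)]; exact hφt y) x (by norm_num)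
  have h1 := hNP x (1 / 2) (by norm_num) (by norm_num) φ (mvfderiv (𝓡 n) φ)
    ⟨hφi, hgi, isWeakDifferentialOn_mvfderiv hφ _⟩
  set c := ⨍ y in Metric.ball x (1 / 2), φ y ∂μHE[n]
  refine ⟨c, ?_⟩
  have hBfin : (μHE[n] : Measure M) (Metric.ball x (1 / 2)) ≠ ⊤ :=
    (h.measure_ball_lt_top x _ (by norm_num)).ne
  have hI : IntegrableOn (fun y => |φ y - c|) (Metric.ball x (1 / 2)) μHE[n] :=
    (hφi.sub (integrableOn_const hBfin)).abs
  rw [← ofReal_integral_eq_lintegral_ofReal hI (ae_of_all _ fun y => abs_nonneg _)] at h1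
  change _ ≤ _ * ∫⁻ y in Metric.ball x (1 / 2), ENNReal.ofReal (gradNorm n φ y) ∂μHE[n] at h1
  rw [← ofReal_integral_eq_lintegral_ofReal hgi (ae_of_all _ (gradNorm_nonneg φ)),
    ← ENNReal.ofReal_mul (by positivity)] at h1
  have h2 := (ENNReal.ofReal_le_ofReal_iff
    (mul_nonneg (by positivity) (integral_nonneg (gradNorm_nonneg φ)))).1 h1
  rwa [mul_one_div] at h2

theorem isParabolic_of_isMParabolic (hVD : LocalVolumeDoubling n M)
    (hNP : LocalNeumannPoincare n M) (hp : IsMParabolic n M) : IsParabolic n M := by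
  obtain ⟨C, hC, hVD⟩ := hVD
  obtain ⟨D, hD, hNP⟩ := hNP
  obtain ⟨t, ht, K, hK, hKpos, hcap⟩ := hp
  have h : LocalDoubling (μHE[n] : Measure M) C :=
    localDoubling_of_measure_ne_zero hC hVD exists_measure_ball_lt_top
      fun h0 => hKpos.ne' (measure_mono_null (subset_univ K) h0)
  -- Every neighbourhood of this point meets `K` in positive measure.
  obtain ⟨p, hpK, hpos⟩ := exists_mem_forall_mem_nhdsWithin_pos_measure hKpos.ne'
  have hKp := hpos _ (inter_mem_nhdsWithin K (Metric.ball_mem_nhds p (by norm_num : (0 : ℝ) < 1 / 2)))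
  have hN : 0 ≤ D / 2 := by linarith
  obtain ⟨E, hE, hthr⟩ := h.exists_energy_threshold hK.measurableSet hKp ht hN
  -- The compact set changes: the average need not be constant on `K`, but it is at least `t / 2` on
  -- this ball.
  refine ⟨Metric.closedBall p (1 / 8), (h.isCompact_closedBall p).of_isClosed_subset
    Metric.isClosed_closedBall (Metric.closedBall_subset_closedBall (by norm_num)),
    (h.measure_ball_pos p (1 / 8) (by norm_num)).trans_le
      (measure_mono Metric.ball_subset_closedBall), ?_⟩
  set A := (8 * C ^ 3 * (1 + 2 * C ^ 3)) ^ 2 * max (t ^ 2) (16 * (D / 2) ^ 2)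
  have hA : 0 < A := mul_pos (by positivity) (lt_max_of_lt_left (by positivity))
  rw [← nonpos_iff_eq_zero]
  refine ENNReal.le_of_forall_pos_le_add fun δ hδ _ => ?_
  rw [zero_add]
  -- The first bound activates the threshold; the second makes the final Dirichlet energy at most
  -- `δ`.
  set E' := min E (δ / ((2 / t) ^ 2 * A * C))
  have hE' : 0 < E' := lt_min hE (by positivity)
  have hlt : graphCap n t K univ < ENNReal.ofReal E' := by
    rw [hcap]; exact ENNReal.ofReal_pos.2 hE'
  simp only [graphCap, iInf_lt_iff] at hlt
  obtain ⟨φ, ⟨hφL, hφc, -, hφb, hφK⟩, hφE⟩ := hlt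
  rw [Measure.restrict_univ] at hφE
  have hφ0 := fun x => (hφb x).1
  have hφt := fun x => (hφb x).2
  set g := gradNorm n φ
  have hg : Measurable g := measurable_gradNorm φ
  have hg0 : ∀ x, 0 ≤ g x := gradNorm_nonneg φ
  have hΦm : Measurable fun x => √(1 + g x ^ 2) - 1 := by fun_prop
  have hint : Integrable (fun x => √(1 + g x ^ 2) - 1) μHE[n] := by
    refine ⟨hΦm.aestronglyMeasurable, ?_⟩
    rw [hasFiniteIntegral_iff_ofReal (ae_of_all _ fun x => areaIntegrand_nonneg _)]
    exact hφE.trans ENNReal.ofReal_lt_top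
  have hEint : ∫ x, (√(1 + g x ^ 2) - 1) ∂μHE[n] ≤ E' := by
    rw [← ofReal_integral_eq_lintegral_ofReal hint
      (ae_of_all _ fun x => areaIntegrand_nonneg _)] at hφE
    exact ((ENNReal.ofReal_lt_ofReal_iff hE').1 hφE).le
  have hP := exists_poincare_of_locallyLipschitz h hD hNP hφL hφ0 hφt hint
  set S := smoothing (μHE[n] : Measure M) φ
  have hS := hthr φ g hφL.continuous hφ0 hφt hφK hg hg0 hint (hEint.trans (min_le_left _ _)) (hP p)
  set ψ : M → ℝ := fun x => min (2 / t * S x) 1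
  have hψle : ∀ x z, |ψ z - ψ x| ≤ 2 / t * |S z - S x| := by
    intro x z
    refine (abs_min_sub_min_le_max _ _ _ _).trans ?_
    rw [← mul_sub, abs_mul, abs_of_pos (by positivity : 0 < 2 / t)]
    simp only [sub_self, abs_zero]
    exact max_le le_rfl (by positivity)
  have hψ0 : ∀ x, 0 ≤ ψ x := fun x =>
    le_min (mul_nonneg (by positivity) (h.smoothing_nonneg hφ0 x)) zero_le_one
  have hψL : LocallyLipschitz ψ := by
    intro x
    have hC0 : 0 ≤ 2 / t * (8 * C ^ 3 * (1 + 2 * C ^ 3) * t) := by positivity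
    refine ⟨⟨_, hC0⟩, Metric.ball x (1 / 8), Metric.ball_mem_nhds x (by norm_num),
      LipschitzOnWith.of_dist_le_mul fun y hy z hz => ?_⟩
    rw [Metric.mem_ball] at hy hz
    have hyz : dist z y < 1 / 4 := by
      linarith [dist_triangle z x y, dist_comm x y]
    rw [Real.dist_eq, dist_comm y z]
    change _ ≤ 2 / t * (8 * C ^ 3 * (1 + 2 * C ^ 3) * t) * _
    rw [mul_assoc]
    exact (hψle z y).trans (mul_le_mul_of_nonneg_left
      (h.abs_smoothing_sub_le_mul_dist hφL.continuous hφ0 hφt hyz) (by positivity))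
  have hψK : ∀ x ∈ Metric.closedBall p (1 / 8), ψ x = 1 := by
    intro x hx
    refine min_eq_right ?_
    rw [div_mul_eq_mul_div, le_div_iff₀ ht]
    linarith [hS x hx]
  -- The tent vanishes from distance `1/4` on, so `S` is zero unless `x` is that close to `tsupport
  -- φ`, which lies in a compact set.
  have hsupp : IsCompact (closure (tsupport ψ \ Metric.closedBall p (1 / 8))) := by
    have hT : IsCompact (K ∪ closure (tsupport φ \ K)) := hK.union hφc
    obtain ⟨Q, hQ, hnear⟩ := h.exists_compact_of_near hT
    refine hQ.of_isClosed_subset isClosed_closure ?_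
    refine closure_minimal (sdiff_subset.trans ?_) hQ.isClosed
    refine closure_minimal (fun x hx => ?_) hQ.isClosed
    by_contra hxQ
    refine hx ?_
    have hS0 : S x = 0 := by
      have : ∫ y, tent x y * φ y ∂(μHE[n] : Measure M) = 0 := by
        refine (integral_congr_ae (ae_of_all _ fun y => ?_)).trans (integral_zero _ _)
        change tent x y * φ y = 0
        by_cases hxy : dist x y < 1 / 4
        · by_contra hne
          have hy : y ∈ tsupport φ := subset_tsupport φ (right_ne_zero_of_mul hne)
          refine hxQ (hnear x y ?_ hxy)
          by_cases hyK : y ∈ K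
          · exact Or.inl hyK
          · exact Or.inr (subset_closure ⟨hy, hyK⟩)
        · rw [tent_eq_zero (not_lt.1 hxy), zero_mul]
      simp only [S, smoothing, this, zero_div]
    simp [ψ, hS0]
  refine (iInf₂_le ψ ⟨hψL, hsupp, subset_univ _, fun x => ⟨hψ0 x, min_le_right _ _⟩, hψK⟩).trans ?_
  rw [Measure.restrict_univ]
  have hpt : ∀ x, ENNReal.ofReal (gradNorm n ψ x ^ 2) ≤ ENNReal.ofReal ((2 / t) ^ 2 * A) *
      ((∫⁻ y in Metric.ball x (1 / 2), ENNReal.ofReal (√(1 + g y ^ 2) - 1) ∂μHE[n]) /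
        μHE[n] (Metric.ball x (1 / 2))) := by
    intro x
    obtain ⟨L, hL0, hL, hLsq⟩ := h.exists_lipschitz_smoothing hg hg0 hint hφL.continuous hφ0 hφt
      hN (hP x)
    have hgrad : gradNorm n ψ x ≤ 2 / t * L := by
      refine gradNorm_le_of_eventually_le (by positivity) ?_
      filter_upwards [Metric.ball_mem_nhds x (by norm_num : (0 : ℝ) < 1 / 4)] with z hz
      rw [Metric.mem_ball, dist_comm] at hz
      rw [mul_assoc, dist_comm z x]
      exact (hψle x z).trans (mul_le_mul_of_nonneg_left (hL z hz) (by positivity))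
    have hm : 0 < ((μHE[n] : Measure M) (Metric.ball x (1 / 2))).toReal :=
      h.real_ball_pos x (by norm_num) (by norm_num)
    rw [← ofReal_integral_eq_lintegral_ofReal hint.integrableOn
      (ae_of_all _ fun y => areaIntegrand_nonneg _),
      ← ENNReal.ofReal_toReal (h.measure_ball_lt_top x (1 / 2) (by norm_num)).ne,
      ← ENNReal.ofReal_div_of_pos hm, ← ENNReal.ofReal_mul (by positivity)]
    refine ENNReal.ofReal_le_ofReal ?_
    calc gradNorm n ψ x ^ 2 ≤ (2 / t * L) ^ 2 := pow_le_pow_left₀ (gradNorm_nonneg ψ x) hgrad 2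
      _ = (2 / t) ^ 2 * L ^ 2 := mul_pow _ _ _
      _ ≤ _ := by
        rw [mul_assoc]
        exact mul_le_mul_of_nonneg_left hLsq (by positivity)
  calc ∫⁻ x, ENNReal.ofReal (gradNorm n ψ x ^ 2) ∂μHE[n]
      ≤ ENNReal.ofReal ((2 / t) ^ 2 * A) *
        ∫⁻ x, (∫⁻ y in Metric.ball x (1 / 2), ENNReal.ofReal (√(1 + g y ^ 2) - 1) ∂μHE[n]) /
          μHE[n] (Metric.ball x (1 / 2)) ∂μHE[n] := by
        rw [← lintegral_const_mul' _ _ ENNReal.ofReal_ne_top]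
        exact lintegral_mono hpt
    _ ≤ ENNReal.ofReal ((2 / t) ^ 2 * A) * (ENNReal.ofReal C * ENNReal.ofReal E') :=
        mul_le_mul_right ((h.lintegral_average_le hΦm.ennreal_ofReal).trans
          (mul_le_mul_right hφE.le _)) _
    _ = ENNReal.ofReal ((2 / t) ^ 2 * A * C * E') := by
        rw [← ENNReal.ofReal_mul (by positivity), ← ENNReal.ofReal_mul (by positivity)]
        congr 1
        ring
    _ ≤ ENNReal.ofReal δ := by
        refine ENNReal.ofReal_le_ofReal ?_
        rw [mul_comm, ← le_div_iff₀ (by positivity)]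
        exact min_le_right _ _
    _ = δ := ENNReal.ofReal_coe_nnreal

end Manifold

end GraphCapacity

theorem mainTheorem4 {n : ℕ} {M : Type*} [MetricSpace M] [ConnectedSpace M]
    [SecondCountableTopology M] [ChartedSpace (EuclideanSpace ℝ (Fin n)) M] [IsManifold (𝓡 n) ∞ M]
    [Bundle.RiemannianBundle (fun x : M => TangentSpace (𝓡 n) x)]
    [IsContMDiffRiemannianBundle (𝓡 n) ∞ (EuclideanSpace ℝ (Fin n))
      (fun x : M => TangentSpace (𝓡 n) x)]
    [IsRiemannianManifold (𝓡 n) M] [CompleteSpace M]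
    [MeasurableSpace M] [BorelSpace M]
    (hVD : GraphCapacity.LocalVolumeDoubling n M)
    (hNP : GraphCapacity.LocalNeumannPoincare n M) :
    GraphCapacity.IsParabolic n M ↔ GraphCapacity.IsMParabolic n M := by
  exact ⟨GraphCapacity.isMParabolic_of_isParabolic,
    GraphCapacity.isParabolic_of_isMParabolic hVD hNP⟩
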